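/- Let $p$ be a prime and let $l_1,l_2,l_3,l_4$ be natural numbers, each coprime to $p$. Put $n=l_1l_2l_3l_4$ and let $\zeta$ be a primitive $n$-th root of unity in a field of characteristic $0$. Then the group $$G=\mathbb{Z}/l_1\mathbb{Z}\times\mathbb{Z}/l_2\mathbb{Z}\times\mathbb{Z}/l_3\mathbb{Z}\times\mathbb{Z}/l_4\mathbb{Z}$$ is admissible over the rational function field $F=\mathbb{Q}(\zeta)(t)$ in one variable over $\mathbb{Q}(\zeta)$; that is, there exist a finite-dimensional division algebra $D$ over $F$ with centre $F$ and a maximal subfield $L$ of $D$ (maximal under inclusion among the commutative division subrings of $D$) such that $L$ is a finite Galois extension of $F$ with $\operatorname{Gal}(L/F)\cong G$. -/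

import Mathlib

open scoped IntermediateField

universe u

/-- `S` is a maximal subfield of the division ring `D`: it is maximal with respect to inclusion
among the commutative division subrings of `D`. (In Mathlib, the terms of `Subfield D` for a
division ring `D` are its division subrings, not necessarily commutative.) -/
def IsMaximalSubfield {D : Type u} [DivisionRing D] (S : Subfield D) : Prop :=
  Maximal (fun T : Subfield D => ∀ x ∈ T, ∀ y ∈ T, x * y = y * x) S

/-- The extension `L` of `F` is `F`-adequate: there is a finite-dimensional division algebra `D`
with centre `F` and an embedding of `L` into `D` over `F` whose image is a maximal subfield
of `D`. -/
def IsAdequate (F L : Type u) [Field F] [Field L] [Algebra F L] : Prop :=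
  ∃ (D : Type u) (_ : DivisionRing D) (_ : Algebra F D) (f : L →ₐ[F] D),
    Algebra.IsCentral F D ∧ FiniteDimensional F D ∧
      IsMaximalSubfield (f : L →+* D).fieldRange

/-- The group `G` is admissible over the field `F`: there is a finite Galois extension `L` of `F`
with Galois group isomorphic to `G` that is `F`-adequate. -/
def IsAdmissible (F : Type u) [Field F] (G : Type*) [Group G] : Prop :=
  ∃ (L : Type u) (_ : Field L) (_ : Algebra F L),
    FiniteDimensional F L ∧ IsGalois F L ∧ Nonempty (Gal(L/F) ≃* G) ∧ IsAdequate F L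

open scoped TensorProduct

/-! Put `K = ℚ(ζ)`, `F = K(t)`, `N₁ = l₁l₂`, `N₂ = l₃l₄`. The division algebra is a tensor product
over `F` of two symbol algebras, `D = (u, ℓ) ⊗ (r, t)` of degrees `N₁` and `N₂`, with generators `i
^ N₁ = u`, `j ^ N₁ = ℓ`, `k ^ N₂ = r`, `m ^ N₂ = t`. The maximal subfield is `L = F(i ^ l₂, j ^ l₁,
k ^ l₄, m ^ l₃)`.

Conjugation by a generator multiplies each monomial in `i, j, k, m` by a root of unity that records
the exponent of its partner. Hence the monomials form a basis, the centre is `F`, and `L` is its own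
centralizer (`dvd_of_commute_pow`). Kummer theory identifies `Gal(L/F)`, as `L` has the largest
degree possible (`isGalois_of_four_radicals`).

The real issue is that `D` has no zero divisors. `noZeroDivisors_of_normalizing` is a valuation
argument in ring-theoretic form: `m` acts as a uniformizer, and the residue ring `A₀ / m ^ N` must
be a domain. It is used twice. Over `ℚ_[ℓ]` with `A₀ = ℤ_[ℓ][x]`, the residue ring is the field
`𝔽_ℓ[X]/(X ^ N₁ - u)`, so `(u, ℓ)` is a domain there. Over `K(t)` with `A₀ = B[t]`, the residue ring
is `B = (u, ℓ) ⊗ K(r ^ (1/N₂))` over `K`. It is a domain because it embeds into the `ℓ`-adic symbol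
algebra: `r ≡ 1` mod `ℓ` is an `N₂`-th power in `ℚ_[ℓ]` by Hensel, while `X ^ N₂ - r` is irreducible
over `K`, being Eisenstein over `ℚ_[r]`. Dirichlet supplies `ℓ` and `r` congruent to `1` modulo
`N₁N₂`, so that `K` embeds into both fields. -/

/-! ### A valuation-style criterion for having no zero divisors -/

open Finset in
/-- A ring `D` generated, up to central units, by a subring `A₀` and a unit `m` normalizing `A₀` has
no zero divisors if `m ^ N` is central, the powers of `m` below `N` are left independent over `A₀`,
`A₀` is separated for `m ^ N` and `m ^ N` is completely prime in `A₀`. -/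
theorem noZeroDivisors_of_normalizing {D : Type*} [Ring D] (A₀ : Subring D) (m : D) (N : ℕ)
    (hN : 0 < N) (hm : IsUnit m) (hcomm : ∀ z, m ^ N * z = z * m ^ N) (hmem : m ^ N ∈ A₀)
    (h₁ : ∀ a ∈ A₀, ∃ a' ∈ A₀, m * a = a' * m) (h₂ : ∀ a ∈ A₀, ∃ a' ∈ A₀, a * m = m * a')
    (h₃ : ∀ a : ℕ → D, (∀ s, a s ∈ A₀) → ∑ s ∈ range N, a s * m ^ s = 0 → ∀ s < N, a s = 0)
    (h₄ : ∀ a ∈ A₀, ∀ b ∈ A₀, (∃ c ∈ A₀, a * b = m ^ N * c) →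
      (∃ c ∈ A₀, a = m ^ N * c) ∨ ∃ c ∈ A₀, b = m ^ N * c)
    (h₅ : ∀ a ∈ A₀, (∀ k : ℕ, ∃ c ∈ A₀, a = (m ^ N) ^ k * c) → a = 0)
    (h₆ : ∀ z : D, ∃ w, IsUnit w ∧ (∀ y, w * y = y * w) ∧
      ∃ a : ℕ → D, (∀ s, a s ∈ A₀) ∧ w * z = ∑ s ∈ range N, a s * m ^ s) :
    NoZeroDivisors D := by
  set A : Subring D := Subring.closure (A₀ ∪ {m}) with hA
  have hA₀ : ∀ a ∈ A₀, a ∈ A := fun a ha ↦ Subring.subset_closure (Or.inl ha)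
  have hmA : m ∈ A := Subring.subset_closure (Or.inr rfl)
  have hleft : ∀ z ∈ A, ∃ z' ∈ A, m * z = z' * m := by
    intro z hz
    induction hz using Subring.closure_induction with
    | mem x hx =>
      rcases hx with hx | rfl
      · obtain ⟨a, ha, h⟩ := h₁ x hx
        exact ⟨a, hA₀ a ha, h⟩
      · exact ⟨x, hmA, rfl⟩
    | zero => exact ⟨0, zero_mem _, by simp⟩
    | one => exact ⟨1, one_mem _, by simp⟩
    | add x y _ _ hx hy =>
      obtain ⟨x', hx', ex⟩ := hx
      obtain ⟨y', hy', ey⟩ := hy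
      exact ⟨x' + y', add_mem hx' hy', by rw [mul_add, ex, ey, add_mul]⟩
    | neg x _ hx =>
      obtain ⟨x', hx', ex⟩ := hx
      exact ⟨-x', neg_mem hx', by rw [mul_neg, ex, neg_mul]⟩
    | mul x y _ _ hx hy =>
      obtain ⟨x', hx', ex⟩ := hx
      obtain ⟨y', hy', ey⟩ := hy
      exact ⟨x' * y', mul_mem hx' hy', by rw [← mul_assoc, ex, mul_assoc, ey, mul_assoc]⟩
  have hright : ∀ z ∈ A, ∃ z' ∈ A, z * m = m * z' := by
    intro z hz
    induction hz using Subring.closure_induction with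
    | mem x hx =>
      rcases hx with hx | rfl
      · obtain ⟨a, ha, h⟩ := h₂ x hx
        exact ⟨a, hA₀ a ha, h⟩
      · exact ⟨x, hmA, rfl⟩
    | zero => exact ⟨0, zero_mem _, by simp⟩
    | one => exact ⟨1, one_mem _, by simp⟩
    | add x y _ _ hx hy =>
      obtain ⟨x', hx', ex⟩ := hx
      obtain ⟨y', hy', ey⟩ := hy
      exact ⟨x' + y', add_mem hx' hy', by rw [add_mul, ex, ey, mul_add]⟩
    | neg x _ hx =>
      obtain ⟨x', hx', ex⟩ := hx
      exact ⟨-x', neg_mem hx', by rw [neg_mul, ex, mul_neg]⟩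
    | mul x y _ _ hx hy =>
      obtain ⟨x', hx', ex⟩ := hx
      obtain ⟨y', hy', ey⟩ := hy
      exact ⟨x' * y', mul_mem hx' hy', by rw [mul_assoc, ey, ← mul_assoc, ex, mul_assoc]⟩
  have hleftpow : ∀ (k : ℕ), ∀ z ∈ A, ∃ z' ∈ A, m ^ k * z = z' * m ^ k := by
    intro k
    induction k with
    | zero => exact fun z hz ↦ ⟨z, hz, by simp⟩
    | succ k ih =>
      intro z hz
      obtain ⟨z', hz', e⟩ := hleft z hz
      obtain ⟨z'', hz'', e'⟩ := ih z' hz'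
      exact ⟨z'', hz'', by rw [pow_succ, mul_assoc, e, ← mul_assoc, e', mul_assoc]⟩
  have hrightpow : ∀ (k : ℕ), ∀ z ∈ A, ∃ z' ∈ A, z * m ^ k = m ^ k * z' := by
    intro k
    induction k with
    | zero => exact fun z hz ↦ ⟨z, hz, by simp⟩
    | succ k ih =>
      intro z hz
      obtain ⟨z', hz', e⟩ := ih z hz
      obtain ⟨z'', hz'', e'⟩ := hright z' hz'
      exact ⟨z'', hz'', by rw [pow_succ, ← mul_assoc, e, mul_assoc, e', mul_assoc]⟩
  have hdecomp : ∀ z ∈ A, ∃ z₀ ∈ A₀, ∃ z₁ ∈ A, z = z₀ + m * z₁ := by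
    intro z hz
    induction hz using Subring.closure_induction with
    | mem x hx =>
      rcases hx with hx | rfl
      · exact ⟨x, hx, 0, zero_mem _, by simp⟩
      · exact ⟨0, zero_mem _, 1, one_mem _, by simp⟩
    | zero => exact ⟨0, zero_mem _, 0, zero_mem _, by simp⟩
    | one => exact ⟨1, one_mem _, 0, zero_mem _, by simp⟩
    | add x y _ _ hx hy =>
      obtain ⟨x₀, hx₀, x₁, hx₁, rfl⟩ := hx
      obtain ⟨y₀, hy₀, y₁, hy₁, rfl⟩ := hy
      exact ⟨x₀ + y₀, add_mem hx₀ hy₀, x₁ + y₁, add_mem hx₁ hy₁, by noncomm_ring⟩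
    | neg x _ hx =>
      obtain ⟨x₀, hx₀, x₁, hx₁, rfl⟩ := hx
      exact ⟨-x₀, neg_mem hx₀, -x₁, neg_mem hx₁, by noncomm_ring⟩
    | mul x y _ hy' hx hy =>
      obtain ⟨x₀, hx₀, x₁, hx₁, rfl⟩ := hx
      obtain ⟨y₀, hy₀, y₁, hy₁, rfl⟩ := hy
      obtain ⟨x', hx', e⟩ := h₂ x₀ hx₀
      refine ⟨x₀ * y₀, mul_mem hx₀ hy₀, x' * y₁ + x₁ * (y₀ + m * y₁),
        add_mem (mul_mem (hA₀ _ hx') hy₁) (mul_mem hx₁ hy'), ?_⟩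
      rw [mul_add m, ← mul_assoc m x', ← e]
      noncomm_ring
  -- The left `A₀`-combinations of `1, m, …, m ^ (N - 1)`. They exhaust `A`, since they contain `1`
  -- and are stable under left multiplication by `A`.
  let S : AddSubgroup D :=
    { carrier := {z | ∃ a : ℕ → D, (∀ s, a s ∈ A₀) ∧ z = ∑ s ∈ range N, a s * m ^ s}
      zero_mem' := ⟨0, fun _ ↦ zero_mem _, by simp⟩
      add_mem' := by
        rintro _ _ ⟨a, ha, rfl⟩ ⟨b, hb, rfl⟩
        exact ⟨a + b, fun s ↦ add_mem (ha s) (hb s), by simp [add_mul, sum_add_distrib]⟩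
      neg_mem' := by
        rintro _ ⟨a, ha, rfl⟩
        exact ⟨-a, fun s ↦ neg_mem (ha s), by simp⟩ }
  have hSA₀ : ∀ a ∈ A₀, ∀ s < N, a * m ^ s ∈ S := by
    intro a ha s hs
    refine ⟨Pi.single s a, fun t ↦ ?_, ?_⟩
    · by_cases h : t = s
      · subst h; simpa using ha
      · simp [h, zero_mem]
    · rw [sum_eq_single s] <;> simp +contextual [hs]
  have hAS : ∀ z ∈ A, ∀ w ∈ S, z * w ∈ S := by
    intro z hz
    induction hz using Subring.closure_induction with
    | mem x hx =>
      rintro _ ⟨a, ha, rfl⟩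
      rw [mul_sum]
      refine sum_mem fun s hs ↦ ?_
      rw [mem_range] at hs
      rcases hx with hx | rfl
      · rw [← mul_assoc]
        exact hSA₀ _ (mul_mem hx (ha s)) s hs
      · obtain ⟨a', ha', e⟩ := h₁ (a s) (ha s)
        rw [← mul_assoc, e, mul_assoc, ← pow_succ']
        rcases Nat.lt_or_ge (s + 1) N with h | h
        · exact hSA₀ _ ha' _ h
        · obtain rfl : s + 1 = N := by omega
          simpa using hSA₀ _ (mul_mem ha' hmem) 0 hN
    | zero => intro w _; simp
    | one => intro w hw; simpa using hw
    | add x y _ _ hx hy => intro w hw; rw [add_mul]; exact add_mem (hx w hw) (hy w hw)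
    | neg x _ hx => intro w hw; rw [neg_mul]; exact neg_mem (hx w hw)
    | mul x y _ _ hx hy => intro w hw; rw [mul_assoc]; exact hx _ (hy w hw)
  have hS : ∀ z ∈ A, z ∈ S := fun z hz ↦ by
    simpa using hAS z hz 1 (by simpa using hSA₀ 1 (one_mem _) 0 hN)
  -- `A₀ ∩ mA = m ^ N A₀`: in `m * ∑ b s m ^ s` the only term without a lower positive power of `m`
  -- comes from `s = N - 1`, and it lies in `A₀ m ^ N`.
  have hinter : ∀ a ∈ A₀, (∃ z ∈ A, a = m * z) → ∃ c ∈ A₀, a = m ^ N * c := by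
    rintro a ha ⟨z, hz, e⟩
    obtain ⟨b, hb, rfl⟩ := hS z hz
    choose b' hb' eb using fun s ↦ h₁ (b s) (hb s)
    obtain ⟨n, rfl⟩ : ∃ n, N = n + 1 := ⟨N - 1, by omega⟩
    have key : ∑ s ∈ range (n + 1), (fun s ↦ Nat.casesOn s (a - b' n * m ^ (n + 1))
        (fun s ↦ -b' s) : ℕ → D) s * m ^ s = 0 := by
      rw [sum_range_succ']
      rw [mul_sum, sum_range_succ] at e
      simp only [← mul_assoc, eb] at e
      simp only [mul_assoc, ← pow_succ'] at e
      simp only [pow_zero, mul_one, e, neg_mul, sum_neg_distrib]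
      exact (fun p q ↦ by abel : ∀ p q : D, -p + (p + q - q) = 0) _ _
    have := h₃ _ (fun s ↦ ?_) key 0 hN
    · exact ⟨b' n, hb' n, by rw [hcomm]; exact sub_eq_zero.mp this⟩
    · cases s with
      | zero => exact sub_mem ha (mul_mem (hb' n) hmem)
      | succ s => exact neg_mem (hb' s)
  -- Modulo `m` only the components `x₀, y₀` in `A₀` survive, so complete primality of `m ^ N` in
  -- `A₀` passes to `m` in `A`.
  have hprime : ∀ x ∈ A, ∀ y ∈ A, (∃ z ∈ A, x * y = m * z) →
      (∃ z ∈ A, x = m * z) ∨ ∃ z ∈ A, y = m * z := by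
    rintro x hx y hy ⟨z, hz, e⟩
    obtain ⟨x₀, hx₀, x₁, hx₁, rfl⟩ := hdecomp x hx
    obtain ⟨y₀, hy₀, y₁, hy₁, rfl⟩ := hdecomp y hy
    obtain ⟨x', hx', e'⟩ := h₂ x₀ hx₀
    have hc : ∀ a₀ : D, (∃ c ∈ A₀, a₀ = m ^ N * c) → ∀ a₁ ∈ A, ∃ z ∈ A, a₀ + m * a₁ = m * z := by
      rintro _ ⟨c, hc, rfl⟩ a₁ ha₁
      obtain ⟨n, rfl⟩ : ∃ n, N = n + 1 := ⟨N - 1, by omega⟩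
      exact ⟨m ^ n * c + a₁, add_mem (mul_mem (pow_mem hmA _) (hA₀ _ hc)) ha₁, by
        rw [pow_succ']; noncomm_ring⟩
    have := h₄ x₀ hx₀ y₀ hy₀ (hinter _ (mul_mem hx₀ hy₀)
      ⟨z - x' * y₁ - x₁ * (y₀ + m * y₁), sub_mem (sub_mem hz (mul_mem (hA₀ _ hx') hy₁))
        (mul_mem hx₁ hy), by
        rw [mul_sub, mul_sub, ← e, ← mul_assoc m x', ← e']; noncomm_ring⟩)
    exact this.imp (fun h ↦ hc _ h _ hx₁) (fun h ↦ hc _ h _ hy₁)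
  -- A nonzero element has a finite order at `m`. Divisibility by `m ^ (N * k)`, a central element,
  -- is coefficientwise, so divisibility for all `k` would kill every coefficient.
  have hsep : ∀ z ∈ A, z ≠ 0 → ∃ (e : ℕ) (z' : D), z' ∈ A ∧ z = m ^ e * z' ∧
      ¬ ∃ w ∈ A, z' = m * w := by
    intro z hz hz0
    have hex : ∃ k : ℕ, ¬ ∃ w ∈ A, z = m ^ k * w := by
      by_contra! hall
      apply hz0
      obtain ⟨a, ha, rfl⟩ := hS z hz
      refine sum_eq_zero fun s hs ↦ ?_
      rw [h₅ (a s) (ha s) fun k ↦ ?_, zero_mul]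
      obtain ⟨w, hw, e⟩ := hall (N * k)
      obtain ⟨b, hb, rfl⟩ := hS w hw
      have hck : ∀ z, (m ^ N) ^ k * z = z * (m ^ N) ^ k := fun z ↦
        ((show Commute (m ^ N) z from hcomm z).pow_left k).eq
      have := h₃ (fun s ↦ a s - (m ^ N) ^ k * b s)
        (fun s ↦ sub_mem (ha s) (mul_mem (pow_mem hmem k) (hb s))) (by
          simp only [sub_mul, sum_sub_distrib, mul_assoc, ← mul_sum]
          rw [e, pow_mul, sub_self]) s (mem_range.mp hs)
      exact ⟨b s, hb s, sub_eq_zero.mp this⟩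
    classical
    have h0 : Nat.find hex ≠ 0 := fun h ↦ by
      have := Nat.find_spec hex
      rw [h] at this
      exact this ⟨z, hz, by simp⟩
    obtain ⟨e, he⟩ : ∃ e, Nat.find hex = e + 1 := ⟨Nat.find hex - 1, by omega⟩
    have hmin := Nat.find_min hex (show e < Nat.find hex by omega)
    rw [not_not] at hmin
    obtain ⟨z', hz', ez⟩ := hmin
    refine ⟨e, z', hz', ez, ?_⟩
    rintro ⟨w, hw, rfl⟩
    have := Nat.find_spec hex
    rw [he] at this
    exact this ⟨w, hw, by rw [ez, pow_succ, mul_assoc]⟩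
  have main : ∀ x ∈ A, ∀ y ∈ A, x * y = 0 → x = 0 ∨ y = 0 := by
    intro x hx y hy hxy
    by_contra! hne
    obtain ⟨e, x', hx', ex, nx⟩ := hsep x hx hne.1
    obtain ⟨f, y', hy', ey, ny⟩ := hsep y hy hne.2
    -- Moving `m ^ f` across `x'` lets all powers of `m` be cancelled, leaving a zero product of
    -- elements of order `0`.
    obtain ⟨x'', hx'', ex'⟩ := hrightpow f x' hx'
    have hz : x'' * y' = 0 := by
      have h : m ^ (e + f) * (x'' * y') = m ^ (e + f) * 0 := by
        rw [mul_zero, ← hxy, ex, ey, mul_assoc (m ^ e), ← mul_assoc x', ex', pow_add]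
        simp only [mul_assoc]
      exact (hm.pow _).mul_left_cancel h
    rcases hprime x'' hx'' y' hy' ⟨0, zero_mem _, by simp [hz]⟩ with ⟨z, hzA, rfl⟩ | h
    · obtain ⟨z', hz', ez⟩ := hleftpow f z hzA
      refine nx ⟨z', hz', (hm.pow f).mul_right_cancel ?_⟩
      rw [ex', ← mul_assoc, ← pow_succ, pow_succ', mul_assoc, ez, mul_assoc]
    · exact ny h
  refine ⟨fun {x y} hxy ↦ ?_⟩
  -- Clearing central unit denominators reduces `D` to `A`.
  have hform : ∀ z : D, ∃ w, IsUnit w ∧ (∀ y, w * y = y * w) ∧ w * z ∈ A := by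
    intro z
    obtain ⟨w, hw, hwc, a, ha, e⟩ := h₆ z
    exact ⟨w, hw, hwc, e ▸ sum_mem fun s _ ↦ mul_mem (hA₀ _ (ha s)) (pow_mem hmA s)⟩
  obtain ⟨v, hv, hvc, hvx⟩ := hform x
  obtain ⟨w, hw, hwc, hwy⟩ := hform y
  have := main _ hvx _ hwy (by rw [mul_assoc, ← mul_assoc x, ← hwc x, mul_assoc, hxy]; simp)
  exact this.imp (fun h ↦ hv.mul_right_eq_zero.mp h) (fun h ↦ hw.mul_right_eq_zero.mp h)

/-! ### Spanning sets of generated subalgebras, and the criterion in coordinates -/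

/-- Adjoining a normalizing element `x` with `x ^ N ∈ S` to the subalgebra `S`. -/
theorem toSubmodule_adjoin_insert_eq_span {R A κ : Type*} [CommRing R] [Ring A] [Algebra R A]
    (T : Set A) (b : κ → A)
    (hb : Subalgebra.toSubmodule (Algebra.adjoin R T) = Submodule.span R (Set.range b))
    (x : A) (N : ℕ) (hN : 0 < N) (hx : x ^ N ∈ Algebra.adjoin R T)
    (hcomm : ∀ s ∈ Algebra.adjoin R T, ∃ s' ∈ Algebra.adjoin R T, x * s = s' * x) :
    Subalgebra.toSubmodule (Algebra.adjoin R (insert x T)) =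
      Submodule.span R (Set.range fun p : κ × Fin N ↦ b p.1 * x ^ (p.2 : ℕ)) := by
  set M := Submodule.span R (Set.range fun p : κ × Fin N ↦ b p.1 * x ^ (p.2 : ℕ)) with hM
  have hmem : ∀ y, y ∈ Algebra.adjoin R T ↔ y ∈ Submodule.span R (Set.range b) := fun y ↦ by
    rw [← hb, Subalgebra.mem_toSubmodule]
  have hTM : ∀ s ∈ Algebra.adjoin R T, ∀ e < N, s * x ^ e ∈ M := by
    intro s hs e he
    have hs' : s ∈ Submodule.span R (Set.range b) := (hmem s).mp hs
    clear hs
    induction hs' using Submodule.span_induction with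
    | mem y hy =>
      obtain ⟨g, rfl⟩ := hy
      exact Submodule.subset_span ⟨(g, ⟨e, he⟩), rfl⟩
    | zero => simp
    | add y z hy hz ihy ihz =>
      rw [add_mul]
      exact add_mem ihy ihz
    | smul r y hy ih =>
      rw [smul_mul_assoc]
      exact M.smul_mem r ih
  have hbT : ∀ g, b g ∈ Algebra.adjoin R T := fun g ↦ by
    rw [hmem]
    exact Submodule.subset_span ⟨g, rfl⟩
  apply le_antisymm
  -- `M` contains `1`, so stability under left multiplication by the generators suffices.
  · have key : ∀ z ∈ Algebra.adjoin R (insert x T), ∀ w ∈ M, z * w ∈ M := by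
      intro z hz
      induction hz using Algebra.adjoin_induction with
      | mem y hy =>
        intro w hw
        induction hw using Submodule.span_induction with
        | mem w hw =>
          obtain ⟨⟨g, e⟩, rfl⟩ := hw
          change y * (b g * x ^ (e : ℕ)) ∈ M
          rcases hy with rfl | hy
          · obtain ⟨s', hs', h⟩ := hcomm (b g) (hbT g)
            rw [← mul_assoc, h, mul_assoc, ← pow_succ']
            rcases Nat.lt_or_ge (e + 1) N with h | h
            · exact hTM _ hs' _ h
            · have he : (e : ℕ) + 1 = N := by omega
              rw [he]
              simpa using hTM _ (mul_mem hs' hx) 0 hN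
          · rw [← mul_assoc]
            exact hTM _ (mul_mem (Algebra.subset_adjoin hy) (hbT g)) _ e.2
        | zero => simp
        | add w₁ w₂ _ _ h₁ h₂ => rw [mul_add]; exact add_mem h₁ h₂
        | smul r w _ h => rw [mul_smul_comm]; exact M.smul_mem r h
      | algebraMap r => intro w hw; rw [← Algebra.smul_def]; exact M.smul_mem r hw
      | add y z _ _ hy hz => intro w hw; rw [add_mul]; exact add_mem (hy w hw) (hz w hw)
      | mul y z _ _ hy hz => intro w hw; rw [mul_assoc]; exact hy _ (hz w hw)
    intro z hz
    simpa using key z hz 1 (by simpa using hTM 1 (one_mem _) 0 hN)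
  · rw [hM, Submodule.span_le]
    rintro _ ⟨⟨g, e⟩, rfl⟩
    exact (Algebra.adjoin R (insert x T)).mul_mem
      (Algebra.adjoin_mono (Set.subset_insert _ _) (hbT g))
      (pow_mem (Algebra.subset_adjoin (Set.mem_insert _ _)) _)

/-- The normalizing condition can be checked on generators. -/
theorem exists_mul_eq_mul_of_mem_adjoin {R A : Type*} [CommRing R] [Ring A] [Algebra R A]
    (T : Set A) (x : A) (h : ∀ s ∈ T, ∃ s' ∈ Algebra.adjoin R T, x * s = s' * x) :
    ∀ s ∈ Algebra.adjoin R T, ∃ s' ∈ Algebra.adjoin R T, x * s = s' * x := by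
  intro z hz
  induction hz using Algebra.adjoin_induction with
  | mem y hy => exact h y hy
  | algebraMap r => exact ⟨algebraMap R A r, algebraMap_mem _ r, (Algebra.commutes r x).symm⟩
  | add x y _ _ hx hy =>
    obtain ⟨x', hx', ex⟩ := hx
    obtain ⟨y', hy', ey⟩ := hy
    exact ⟨x' + y', add_mem hx' hy', by rw [mul_add, ex, ey, add_mul]⟩
  | mul x y _ _ hx hy =>
    obtain ⟨x', hx', ex⟩ := hx
    obtain ⟨y', hy', ey⟩ := hy
    exact ⟨x' * y', mul_mem hx' hy', by rw [← mul_assoc, ex, mul_assoc, ey, mul_assoc]⟩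

/-- The opposite normalizing condition can be checked on generators. -/
theorem exists_mul_eq_mul_of_mem_adjoin' {R A : Type*} [CommRing R] [Ring A] [Algebra R A]
    (T : Set A) (x : A) (h : ∀ s ∈ T, ∃ s' ∈ Algebra.adjoin R T, s * x = x * s') :
    ∀ s ∈ Algebra.adjoin R T, ∃ s' ∈ Algebra.adjoin R T, s * x = x * s' := by
  intro z hz
  induction hz using Algebra.adjoin_induction with
  | mem y hy => exact h y hy
  | algebraMap r => exact ⟨algebraMap R A r, algebraMap_mem _ r, Algebra.commutes r x⟩
  | add x y _ _ hx hy =>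
    obtain ⟨x', hx', ex⟩ := hx
    obtain ⟨y', hy', ey⟩ := hy
    exact ⟨x' + y', add_mem hx' hy', by rw [add_mul, ex, ey, mul_add]⟩
  | mul x y _ _ hx hy =>
    obtain ⟨x', hx', ex⟩ := hx
    obtain ⟨y', hy', ey⟩ := hy
    exact ⟨x' * y', mul_mem hx' hy', by rw [mul_assoc, ey, ← mul_assoc, ex, mul_assoc]⟩

/-- `noZeroDivisors_of_normalizing` for an algebra over the fraction field of `R`. -/
theorem noZeroDivisors_of_basis {R Q D κ : Type*} [CommRing R] [IsDomain R] [Field Q] [Algebra R Q]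
    [IsFractionRing R Q] [Ring D] [Algebra Q D] [Algebra R D] [IsScalarTower R Q D] [Fintype κ]
    (A₀ : Subalgebra R D) (b : κ → D)
    (hb : Subalgebra.toSubmodule A₀ = Submodule.span R (Set.range b)) (m : D) (N : ℕ) (hN : 0 < N)
    (π : R) (hπ : π ≠ 0) (hsep : ∀ c : R, (∀ k, π ^ k ∣ c) → c = 0)
    (hm : m ^ N = algebraMap R D π)
    (hli : LinearIndependent Q fun p : κ × Fin N ↦ b p.1 * m ^ (p.2 : ℕ))
    (hspan : Submodule.span Q (Set.range fun p : κ × Fin N ↦ b p.1 * m ^ (p.2 : ℕ)) = ⊤)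
    (h₁ : ∀ a ∈ A₀, ∃ a' ∈ A₀, m * a = a' * m) (h₂ : ∀ a ∈ A₀, ∃ a' ∈ A₀, a * m = m * a')
    (h₄ : ∀ x ∈ A₀, ∀ y ∈ A₀, (∃ c ∈ A₀, x * y = π • c) →
      (∃ c ∈ A₀, x = π • c) ∨ ∃ c ∈ A₀, y = π • c) :
    NoZeroDivisors D := by
  have hinj : Function.Injective (algebraMap R Q) := IsFractionRing.injective R Q
  have hπu : ∀ {c : R}, c ≠ 0 → IsUnit (algebraMap R D c) := fun {c} hc ↦ by
    rw [IsScalarTower.algebraMap_apply R Q D]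
    exact (IsUnit.mk0 _ ((map_ne_zero_iff _ hinj).mpr hc)).map _
  have hmem : ∀ z, z ∈ A₀ ↔ ∃ c : κ → R, z = ∑ g, c g • b g := by
    intro z
    rw [← Subalgebra.mem_toSubmodule, hb, Submodule.mem_span_range_iff_exists_fun]
    exact exists_congr fun _ ↦ eq_comm
  have hsmul : ∀ (c : R) (z : D), c • z = algebraMap R Q c • z := fun c z ↦
    (algebraMap_smul Q c z).symm
  have hcoord : ∀ c : κ × Fin N → Q, ∑ p, c p • (b p.1 * m ^ (p.2 : ℕ)) = 0 → ∀ p, c p = 0 :=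
    Fintype.linearIndependent_iff.mp hli
  have hcoord₀ : ∀ c : κ → R, ∑ g, c g • b g = 0 → ∀ g, c g = 0 := by
    intro c hc g
    -- Independence of `b` is the part of `hli` with exponent `0` at `m`.
    have := hcoord (fun p ↦ if p.2 = ⟨0, hN⟩ then algebraMap R Q (c p.1) else 0) (by
      rw [Fintype.sum_prod_type]
      simpa [ite_smul, ← hsmul] using hc) (g, ⟨0, hN⟩)
    simpa using this
  refine noZeroDivisors_of_normalizing A₀.toSubring m N hN ?_ ?_ ?_ h₁ h₂ ?_ ?_ ?_ ?_
  · rw [← isUnit_pow_iff hN.ne', hm]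
    exact hπu hπ
  · intro z
    rw [hm]
    exact Algebra.commutes _ _
  · rw [hm]
    exact algebraMap_mem A₀ π
  · intro a ha hsum s hs
    choose c hc using fun s ↦ (hmem (a s)).mp (ha s)
    have := hcoord (fun p ↦ algebraMap R Q (c p.2 p.1)) (by
      rw [Fintype.sum_prod_type_right, ← hsum, Finset.sum_range]
      refine Finset.sum_congr rfl fun t _ ↦ ?_
      rw [hc t, Finset.sum_mul]
      exact Finset.sum_congr rfl fun g _ ↦ by rw [← hsmul, smul_mul_assoc])
    rw [hc s]
    refine Finset.sum_eq_zero fun g _ ↦ ?_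
    have h := this (g, ⟨s, hs⟩)
    rw [map_eq_zero_iff _ hinj] at h
    simp only at h
    rw [h, zero_smul]
  · simp only [hm, ← Algebra.smul_def]
    exact h₄
  · intro a ha hdiv
    obtain ⟨c, rfl⟩ := (hmem a).mp ha
    refine Finset.sum_eq_zero fun g _ ↦ ?_
    rw [hsep (c g), zero_smul]
    intro k
    obtain ⟨d, hd, e⟩ := hdiv k
    obtain ⟨d, rfl⟩ := (hmem d).mp hd
    rw [hm, ← map_pow, ← Algebra.smul_def, Finset.smul_sum] at e
    have := hcoord₀ (fun g ↦ c g - π ^ k * d g) (by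
      simp only [sub_smul, Finset.sum_sub_distrib, mul_smul]
      rw [e, sub_self]) g
    exact ⟨d g, sub_eq_zero.mp this⟩
  · intro z
    obtain ⟨c, hc⟩ := (Submodule.mem_span_range_iff_exists_fun Q).mp
      (show z ∈ Submodule.span Q (Set.range fun p : κ × Fin N ↦ b p.1 * m ^ (p.2 : ℕ)) from
        hspan ▸ Submodule.mem_top)
    -- A common denominator of the coordinates serves as the central unit.
    obtain ⟨⟨w, hw⟩, hwc⟩ := IsLocalization.exist_integer_multiples_of_finite
      (nonZeroDivisors R) c
    choose d hd using hwc
    refine ⟨algebraMap R D w, hπu (nonZeroDivisors.ne_zero hw), Algebra.commutes _,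
      fun s ↦ if hs : s < N then ∑ g, d (g, ⟨s, hs⟩) • b g else 0, fun s ↦ ?_, ?_⟩
    · simp only
      split_ifs with hs
      · exact (hmem _).mpr ⟨_, rfl⟩
      · exact zero_mem _
    · rw [← hc, ← Algebra.smul_def, Finset.smul_sum, Fintype.sum_prod_type_right, Finset.sum_range]
      refine Finset.sum_congr rfl fun t _ ↦ ?_
      simp only [dif_pos t.2]
      rw [Finset.sum_mul]
      refine Finset.sum_congr rfl fun g _ ↦ ?_
      rw [smul_mul_assoc, hsmul (d _), hd]
      simp [smul_assoc]

/-! ### Eigenvector independence and irreducibility of `X ^ N - a` -/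

/-- Simultaneous eigenvectors with distinct systems of eigenvalues are linearly independent. -/
theorem linearIndependent_prod_of_eigen {K V κ Λ : Type*} [Field K] [AddCommGroup V] [Module K V]
    [Fintype κ] [Fintype Λ]
    (v : κ × Λ → V) (f : Module.End K V) (μ : Λ → K) (hμ : Function.Injective μ)
    (hv : ∀ p, f (v p) = μ p.2 • v p) (hli : ∀ s, LinearIndependent K fun g ↦ v (g, s)) :
    LinearIndependent K v := by
  rw [Fintype.linearIndependent_iff]
  intro c hc
  have hind := (f.eigenspaces_iSupIndep).comp hμ
  rw [Fintype.sum_prod_type_right] at hc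
  have hmem : ∀ s, ∑ g, c (g, s) • v (g, s) ∈ f.eigenspace (μ s) := fun s ↦
    sum_mem fun g _ ↦ Submodule.smul_mem _ _ (Module.End.mem_eigenspace_iff.mpr (hv (g, s)))
  rintro ⟨g, s⟩
  have h0 : ∀ s, ∑ g, c (g, s) • v (g, s) = 0 := by
    exact fun s ↦ (iSupIndep_iff_finsetSum_eq_zero_imp_eq_zero _).mp hind Finset.univ _
      (fun s _ ↦ hmem s) hc s (Finset.mem_univ s)
  exact Fintype.linearIndependent_iff.mp (hli s) (fun g ↦ c (g, s)) (h0 s) g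

/-- An irreducibility criterion for `X ^ N - a`, proved by taking norms of a root. -/
theorem irreducible_X_pow_sub_C_of_forall_pow_eq {F : Type*} [Field F] {N : ℕ} (hN : 0 < N) (a : F)
    (h : ∀ (b : F) (d : ℕ), b ^ N = a ^ d → N ∣ d) :
    Irreducible (Polynomial.X ^ N - Polynomial.C a : Polynomial F) := by
  open Polynomial in
  have hdeg : (X ^ N - C a : F[X]).natDegree = N := natDegree_X_pow_sub_C
  have hmon : (X ^ N - C a : F[X]).Monic := monic_X_pow_sub_C a hN.ne'
  obtain ⟨g, hgm, hgi, q, hq⟩ := exists_monic_irreducible_factor (X ^ N - C a : F[X])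
    (fun hu ↦ hN.ne' (by rw [← hdeg, natDegree_eq_zero_of_isUnit hu]))
  have := Fact.mk hgi
  have hroot : (AdjoinRoot.root g) ^ N = AdjoinRoot.of g a := by
    have := congrArg (AdjoinRoot.mk g) hq
    rw [map_mul, AdjoinRoot.mk_self, zero_mul] at this
    simpa [sub_eq_zero] using this
  have hfin : Module.finrank F (AdjoinRoot g) = g.natDegree := by
    rw [(AdjoinRoot.powerBasis hgi.ne_zero).finrank, AdjoinRoot.powerBasis_dim]
  -- The norm `b` of a root of the factor `g` satisfies `b ^ N = a ^ deg g`, so `N ∣ deg g` and `g`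
  -- is everything.
  have hdvd := h (Algebra.norm F (AdjoinRoot.root g)) g.natDegree (by
    rw [← map_pow, hroot, ← AdjoinRoot.algebraMap_eq, Algebra.norm_algebraMap, hfin])
  have hle : N ≤ g.natDegree := Nat.le_of_dvd hgi.natDegree_pos hdvd
  have : X ^ N - C a = g := (eq_of_monic_of_dvd_of_natDegree_le hgm hmon ⟨q, hq⟩ (by omega))
  rwa [this]

/-! ### Symbol pairs and their monomials -/

/-- The defining relations of a symbol algebra `(a, b; ω)_N`, for elements `x`, `y` of an
algebra. -/
structure IsSymbolPair {R A : Type*} [CommRing R] [Ring A] [Algebra R A] (N : ℕ) (ω a b : R)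
    (x y : A) : Prop where
  pow_left : x ^ N = algebraMap R A a
  pow_right : y ^ N = algebraMap R A b
  mul_eq : x * y = ω • (y * x)

theorem mul_pow_eq_smul {R A : Type*} [CommRing R] [Ring A] [Algebra R A] {ω : R} {x y : A}
    (h : x * y = ω • (y * x)) (n : ℕ) : x * y ^ n = ω ^ n • (y ^ n * x) := by
  induction n with
  | zero => simp
  | succ n ih =>
    rw [pow_succ, ← mul_assoc, ih, smul_mul_assoc, mul_assoc, h, mul_smul_comm, smul_smul,
      ← pow_succ, mul_assoc]

theorem pow_mul_eq_smul {R A : Type*} [CommRing R] [Ring A] [Algebra R A] {ω : R} {x y : A}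
    (h : x * y = ω • (y * x)) (n : ℕ) : x ^ n * y = ω ^ n • (y * x ^ n) := by
  induction n with
  | zero => simp
  | succ n ih =>
    rw [pow_succ, mul_assoc, h, mul_smul_comm, ← mul_assoc, ih, smul_mul_assoc, smul_smul,
      ← pow_succ', mul_assoc]

theorem pow_mul_pow_eq_smul {R A : Type*} [CommRing R] [Ring A] [Algebra R A] {ω : R} {x y : A}
    (h : x * y = ω • (y * x)) (k n : ℕ) :
    x ^ k * y ^ n = ω ^ (k * n) • (y ^ n * x ^ k) := by
  rw [mul_pow_eq_smul (pow_mul_eq_smul h k), pow_mul]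

/-- Conjugation by a unit, as a linear map. -/
noncomputable def unitConj (R : Type*) {A : Type*} [CommRing R] [Ring A] [Algebra R A] (x : Aˣ) :
    Module.End R A :=
  LinearMap.mulLeft R (x : A) ∘ₗ LinearMap.mulRight R (↑x⁻¹ : A)

theorem unitConj_apply_of_mul_eq {R A : Type*} [CommRing R] [Ring A] [Algebra R A] {x : Aˣ} {μ : R}
    {z : A} (h : x * z = μ • (z * x)) : unitConj R x z = μ • z := by
  simp [unitConj, ← mul_assoc, h]

namespace IsSymbolPair

section

variable {R A : Type*} [CommRing R] [Ring A] [Algebra R A] {N : ℕ} {ω a b : R} {x y : A}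

theorem map {B : Type*} [Ring B] [Algebra R B] (f : A →ₐ[R] B) (h : IsSymbolPair N ω a b x y) :
    IsSymbolPair N ω a b (f x) (f y) where
  pow_left := by rw [← map_pow, h.pow_left, f.commutes]
  pow_right := by rw [← map_pow, h.pow_right, f.commutes]
  mul_eq := by rw [← map_mul, h.mul_eq, map_smul, map_mul]

theorem of_map {B : Type*} [Ring B] [Algebra R B] (f : A →ₐ[R] B) (hf : Function.Injective f)
    (h : IsSymbolPair N ω a b (f x) (f y)) : IsSymbolPair N ω a b x y where
  pow_left := hf (by rw [map_pow, h.pow_left, f.commutes])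
  pow_right := hf (by rw [map_pow, h.pow_right, f.commutes])
  mul_eq := hf (by rw [map_mul, h.mul_eq, map_smul, map_mul])

/-- Spanning set of the algebra generated by a symbol pair and a set commuting with it. -/
theorem toSubmodule_adjoin_eq_span {κ : Type*} (hN : 0 < N) (h : IsSymbolPair N ω a b x y)
    (hω : IsUnit ω) (T : Set A) (v : κ → A)
    (hv : Subalgebra.toSubmodule (Algebra.adjoin R T) = Submodule.span R (Set.range v))
    (hx : ∀ s ∈ T, Commute x s) (hy : ∀ s ∈ T, Commute y s) :
    Subalgebra.toSubmodule (Algebra.adjoin R (insert y (insert x T))) =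
      Submodule.span R (Set.range fun p : (κ × Fin N) × Fin N ↦
        v p.1.1 * x ^ (p.1.2 : ℕ) * y ^ (p.2 : ℕ)) := by
  refine toSubmodule_adjoin_insert_eq_span (insert x T)
    (fun p : κ × Fin N ↦ v p.1 * x ^ (p.2 : ℕ)) ?_ y N hN
    (by rw [h.pow_right]; exact algebraMap_mem _ _)
    (exists_mul_eq_mul_of_mem_adjoin _ _ ?_)
  · exact toSubmodule_adjoin_insert_eq_span T v hv x N hN
      (by rw [h.pow_left]; exact algebraMap_mem _ _)
      (exists_mul_eq_mul_of_mem_adjoin _ _ fun s hs ↦ ⟨s, Algebra.subset_adjoin hs, hx s hs⟩)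
  · rintro s (rfl | hs)
    · obtain ⟨ω, rfl⟩ := hω
      refine ⟨((ω⁻¹ : Rˣ) : R) • s,
        (Algebra.adjoin R _).smul_mem (Algebra.subset_adjoin (Set.mem_insert _ _)) _, ?_⟩
      rw [smul_mul_assoc, h.mul_eq, smul_smul]
      simp
    · exact ⟨s, Algebra.subset_adjoin (Or.inr hs), hy s hs⟩

end

variable {F A : Type*} [Field F] [Ring A] [Algebra F A] {N : ℕ} {ω a b : F} {x y : A}

theorem isUnit_left (h : IsSymbolPair N ω a b x y) (hN : 0 < N) (ha : a ≠ 0) : IsUnit x := by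
  rw [← isUnit_pow_iff hN.ne', h.pow_left]
  exact (IsUnit.mk0 a ha).map _

theorem isUnit_right (h : IsSymbolPair N ω a b x y) (hN : 0 < N) (hb : b ≠ 0) : IsUnit y := by
  rw [← isUnit_pow_iff hN.ne', h.pow_right]
  exact (IsUnit.mk0 b hb).map _

theorem right_mul_left (h : IsSymbolPair N ω a b x y) (hω : ω ≠ 0) : y * x = ω⁻¹ • (x * y) := by
  rw [h.mul_eq, smul_smul, inv_mul_cancel₀ hω, one_smul]

/-- Conjugation by `x` separates the exponents of `y`, and conjugation by `y` those of `x`, because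
the powers of `ω` below `N` are distinct. For fixed exponents, right multiplication by a unit
preserves independence. Allowing a commuting family `v` makes the lemma iterable for tensor
products. -/
theorem linearIndependent {κ : Type*} [Fintype κ] (h : IsSymbolPair N ω a b x y) (hN : 0 < N)
    (hω : IsPrimitiveRoot ω N) (ha : a ≠ 0) (hb : b ≠ 0) (v : κ → A) (hv : LinearIndependent F v)
    (hx : ∀ g, Commute x (v g)) (hy : ∀ g, Commute y (v g)) :
    LinearIndependent F fun p : (κ × Fin N) × Fin N ↦
        v p.1.1 * x ^ (p.1.2 : ℕ) * y ^ (p.2 : ℕ) := by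
  have hω0 : ω ≠ 0 := hω.ne_zero hN.ne'
  obtain ⟨X, hX⟩ := h.isUnit_left hN ha
  obtain ⟨Y, hY⟩ := h.isUnit_right hN hb
  refine linearIndependent_prod_of_eigen _ (unitConj F X) (fun s : Fin N ↦ ω ^ (s : ℕ))
    (fun s t hst ↦ Fin.ext (hω.pow_inj s.2 t.2 hst)) ?_ fun s ↦ ?_
  · rintro ⟨⟨g, c⟩, d⟩
    apply unitConj_apply_of_mul_eq
    rw [hX]
    simp only
    rw [← mul_assoc, ← mul_assoc, (hx g).eq, mul_assoc (v g), ← pow_succ', mul_assoc (v g),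
      pow_succ, mul_assoc _ x, mul_pow_eq_smul h.mul_eq]
    simp only [mul_smul_comm, mul_assoc]
  refine linearIndependent_prod_of_eigen _ (unitConj F Y) (fun s : Fin N ↦ (ω⁻¹) ^ (s : ℕ))
    (fun s t hst ↦ Fin.ext (hω.inv.pow_inj s.2 t.2 hst)) ?_ fun t ↦ ?_
  · rintro ⟨g, c⟩
    apply unitConj_apply_of_mul_eq
    rw [hY]
    simp only
    rw [← mul_assoc, ← mul_assoc, (hy g).eq, mul_assoc (v g),
      mul_pow_eq_smul (h.right_mul_left hω0)]
    simp only [mul_smul_comm, smul_mul_assoc, mul_assoc, ← pow_succ, ← pow_succ']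
  · have hu : IsUnit (x ^ (t : ℕ) * y ^ (s : ℕ)) :=
      ((h.isUnit_left hN ha).pow _).mul ((h.isUnit_right hN hb).pow _)
    have := hv.map' (LinearMap.mulRight F (x ^ (t : ℕ) * y ^ (s : ℕ))) (by
      rw [LinearMap.ker_eq_bot]
      exact fun z w hzw ↦ hu.mul_right_cancel hzw)
    simpa [Function.comp_def, mul_assoc] using this

end IsSymbolPair

/-- A faithful model of a symbol algebra, inside the endomorphisms of the functions on the group of
roots of unity with values in an algebraic closure. -/
theorem exists_isSymbolPair {F : Type u} [Field F] {N : ℕ} (hN : 0 < N) {ω : F}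
    (hω : IsPrimitiveRoot ω N) (a b : F) :
    ∃ (A : Type u) (_ : Ring A) (_ : Algebra F A) (_ : Nontrivial A) (x y : A),
      IsSymbolPair N ω a b x y := by
  have := NeZero.of_pos hN
  obtain ⟨α, hα⟩ := IsAlgClosed.exists_pow_nat_eq (algebraMap F (AlgebraicClosure F) a) hN
  obtain ⟨β, hβ⟩ := IsAlgClosed.exists_pow_nat_eq (algebraMap F (AlgebraicClosure F) b) hN
  -- `x` is multiplication by `α ξ` and `y` is `β` times translation by `W`; they commute up to the
  -- value `ω` of `W`.
  let W : rootsOfUnity N F := hω.toRootsOfUnity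
  have hW : ((W : Fˣ) : F) = ω := IsPrimitiveRoot.val_toRootsOfUnity_coe hω
  let x : Module.End F (rootsOfUnity N F → AlgebraicClosure F) :=
    { toFun := fun f ξ ↦ α * algebraMap F _ ((ξ : Fˣ) : F) * f ξ
      map_add' := fun f g ↦ by funext ξ; exact mul_add _ _ _
      map_smul' := fun c f ↦ by funext ξ; exact mul_smul_comm c _ (_ : AlgebraicClosure F) }
  let y : Module.End F (rootsOfUnity N F → AlgebraicClosure F) :=
    { toFun := fun f ξ ↦ β * f (W⁻¹ * ξ)
      map_add' := fun f g ↦ by funext ξ; exact mul_add _ _ _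
      map_smul' := fun c f ↦ by funext ξ; exact mul_smul_comm c _ (_ : AlgebraicClosure F) }
  have hxn : ∀ (n : ℕ) (f : rootsOfUnity N F → AlgebraicClosure F) ξ,
      (x ^ n) f ξ = (α * algebraMap F _ ((ξ : Fˣ) : F)) ^ n * f ξ := by
    intro n
    induction n with
    | zero => simp
    | succ n ih =>
      intro f ξ
      rw [pow_succ, Module.End.mul_apply, ih, pow_succ, mul_assoc]
      rfl
  have hyn : ∀ (n : ℕ) (f : rootsOfUnity N F → AlgebraicClosure F) ξ,
      (y ^ n) f ξ = β ^ n * f (W⁻¹ ^ n * ξ) := by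
    intro n
    induction n with
    | zero => simp
    | succ n ih =>
      intro f ξ
      rw [pow_succ, Module.End.mul_apply, ih, pow_succ, pow_succ', mul_assoc, mul_assoc]
      rfl
  have hroot : ∀ ξ : rootsOfUnity N F, ξ ^ N = 1 := fun ξ ↦ Subtype.ext ξ.2
  refine ⟨Module.End F (rootsOfUnity N F → AlgebraicClosure F), inferInstance, inferInstance,
    inferInstance, x, y, ?_, ?_, ?_⟩
  · ext f ξ
    rw [hxn, mul_pow, hα, ← map_pow, ← Units.val_pow_eq_pow_val, ← Subgroup.coe_pow, hroot,
      OneMemClass.coe_one, Units.val_one, map_one, mul_one]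
    rw [Module.algebraMap_end_apply, Pi.smul_apply, Algebra.smul_def]
  · ext f ξ
    rw [hyn, hβ, hroot, one_mul]
    rw [Module.algebraMap_end_apply, Pi.smul_apply, Algebra.smul_def]
  · ext f ξ
    change α * algebraMap F _ ((ξ : Fˣ) : F) * (β * f (W⁻¹ * ξ)) =
      ω • (β * (α * algebraMap F _ (((W⁻¹ * ξ : rootsOfUnity N F) : Fˣ) : F) * f (W⁻¹ * ξ)))
    have h : ((ξ : Fˣ) : F) = ω * (((W⁻¹ * ξ : rootsOfUnity N F) : Fˣ) : F) := by
      rw [← hW, ← Units.val_mul, ← Subgroup.coe_mul, mul_inv_cancel_left]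
    rw [h, Algebra.smul_def, map_mul]
    ring

theorem toSubmodule_adjoin_empty_eq_span (R A : Type*) [CommRing R] [Ring A] [Algebra R A] :
    Subalgebra.toSubmodule (Algebra.adjoin R (∅ : Set A)) =
      Submodule.span R (Set.range fun _ : Unit ↦ (1 : A)) := by
  rw [Algebra.adjoin_empty, Algebra.toSubmodule_bot, Submodule.one_eq_span, Set.range_const]

theorem eq_zero_of_forall_pow_dvd {R : Type*} [CommRing R] [IsDomain R] [WfDvdMonoid R] {π : R}
    (hπ : ¬ IsUnit π) (c : R) (h : ∀ k, π ^ k ∣ c) : c = 0 := by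
  by_contra hc
  obtain ⟨n, hn⟩ := FiniteMultiplicity.of_not_isUnit hπ hc
  exact hn (h _)

theorem linearIndependent_one (F A : Type*) [Field F] [Ring A] [Nontrivial A] [Algebra F A] :
    LinearIndependent F fun _ : Unit ↦ (1 : A) :=
  LinearIndependent.of_subsingleton () one_ne_zero

/-! ### The symbol algebra `(u, ℓ)` over `ℚ_[ℓ]` -/

open Polynomial in
/-- If `x ^ N = u` and the lower powers of `x` are independent, then `X ^ N - u` divides every
polynomial vanishing at `x`. -/
theorem aeval_eq_zero_imp_dvd {R A : Type*} [CommRing R] [Ring A] [Algebra R A] {N : ℕ}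
    (hN : 0 < N) {u : R} {x : A} (hx : x ^ N = algebraMap R A u)
    (hli : LinearIndependent R fun s : Fin N ↦ x ^ (s : ℕ)) (f : R[X]) (hf : aeval x f = 0) :
    X ^ N - C u ∣ f := by
  nontriviality R
  have hmon : (X ^ N - C u : R[X]).Monic := monic_X_pow_sub_C u hN.ne'
  rw [← modByMonic_eq_zero_iff_dvd hmon]
  have hr : aeval x (f %ₘ (X ^ N - C u)) = 0 := by
    rw [modByMonic_eq_sub_mul_div, map_sub, hf, map_mul]
    simp [hx]
  have hdeg : (f %ₘ (X ^ N - C u)).natDegree < N := by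
    have := natDegree_modByMonic_lt f hmon (fun h ↦ by
      have := congrArg natDegree h
      rw [natDegree_X_pow_sub_C, natDegree_one] at this
      omega)
    rwa [natDegree_X_pow_sub_C] at this
  rw [aeval_eq_sum_range' hdeg, Finset.sum_range] at hr
  have := Fintype.linearIndependent_iff.mp hli _ hr
  ext s
  rcases Nat.lt_or_ge s N with h | h
  · exact this ⟨s, h⟩
  · rw [coeff_eq_zero_of_natDegree_lt (by omega), coeff_zero]

open Polynomial in
/-- A symbol algebra `(u, ℓ)` over `ℚ_[ℓ]` has no zero divisors if `X ^ N - u` is irreducible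
modulo `ℓ`. -/
theorem IsSymbolPair.noZeroDivisors_padic {ℓ : ℕ} [Fact ℓ.Prime] {A : Type*} [Ring A] [Nontrivial A]
    [Algebra ℚ_[ℓ] A] {N : ℕ} (hN : 0 < N) {ω : ℚ_[ℓ]} (hω : IsPrimitiveRoot ω N) {u : ℕ}
    (hu : Irreducible (X ^ N - C (u : ZMod ℓ))) (hu0 : u ≠ 0) {x y : A}
    (h : IsSymbolPair N ω (u : ℚ_[ℓ]) (ℓ : ℚ_[ℓ]) x y)
    (htop : Algebra.adjoin ℚ_[ℓ] {y, x} = ⊤) : NoZeroDivisors A := by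
  let : Algebra ℤ_[ℓ] A := Algebra.compHom A (algebraMap ℤ_[ℓ] ℚ_[ℓ])
  have : IsScalarTower ℤ_[ℓ] ℚ_[ℓ] A := IsScalarTower.of_algebraMap_eq fun _ ↦ rfl
  have hℓ : (ℓ : ℚ_[ℓ]) ≠ 0 := by exact_mod_cast (Fact.out : ℓ.Prime).ne_zero
  have hu0' : (u : ℚ_[ℓ]) ≠ 0 := by exact_mod_cast hu0
  have hω0 : ω ≠ 0 := hω.ne_zero hN.ne'
  -- Both `ω` and `ω⁻¹` are then `ℓ`-adic integers, so `y` normalizes `ℤ_[ℓ][x]` from either side.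
  have hωn : ‖ω‖ = 1 := by
    have := congrArg norm hω.pow_eq_one
    rwa [norm_pow, norm_one, pow_eq_one_iff_of_nonneg (norm_nonneg _) hN.ne'] at this
  obtain ⟨w, hw⟩ : ∃ w : ℤ_[ℓ], algebraMap ℤ_[ℓ] ℚ_[ℓ] w = ω := ⟨⟨ω, hωn.le⟩, rfl⟩
  obtain ⟨w', hw'⟩ : ∃ w : ℤ_[ℓ], algebraMap ℤ_[ℓ] ℚ_[ℓ] w = ω⁻¹ :=
    ⟨⟨ω⁻¹, by rw [norm_inv, hωn, inv_one]⟩, rfl⟩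
  have hxN : x ^ N = algebraMap ℤ_[ℓ] A u := by
    rw [h.pow_left, map_natCast, map_natCast]
  have hli := h.linearIndependent hN hω hu0' hℓ (fun _ : Unit ↦ (1 : A))
    (linearIndependent_one _ _) (fun _ ↦ Commute.one_right _) (fun _ ↦ Commute.one_right _)
  have hspan := h.toSubmodule_adjoin_eq_span hN (IsUnit.mk0 _ hω0) ∅ _
    (toSubmodule_adjoin_empty_eq_span _ _) (by simp) (by simp)
  rw [insert_empty_eq, htop, Algebra.top_toSubmodule] at hspan
  have hA₀ := toSubmodule_adjoin_insert_eq_span (R := ℤ_[ℓ]) ∅ (fun _ : Unit ↦ (1 : A))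
    (toSubmodule_adjoin_empty_eq_span _ _) x N hN (by rw [hxN]; exact algebraMap_mem _ _)
    (exists_mul_eq_mul_of_mem_adjoin _ _ (by simp))
  rw [insert_empty_eq] at hA₀
  have hlix : LinearIndependent ℤ_[ℓ] fun s : Fin N ↦ x ^ (s : ℕ) := by
    have := (hli.comp (fun s : Fin N ↦ (((), s), ⟨0, hN⟩))
      (fun s t hst ↦ by simpa using hst)).restrict_scalars (R := ℤ_[ℓ]) (by
        intro a b hab
        exact IsFractionRing.injective ℤ_[ℓ] ℚ_[ℓ] (by simpa [Algebra.smul_def] using hab))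
    simpa [Function.comp_def] using this
  -- Reduction modulo `ℓ` identifies `ℤ_[ℓ][x] / ℓ` with `𝔽_ℓ[X] / (X ^ N - u)`; this is the
  -- injectivity half.
  have hred : ∀ p : ℤ_[ℓ][X], X ^ N - C (u : ZMod ℓ) ∣ p.map PadicInt.toZMod →
      ∃ c ∈ Algebra.adjoin ℤ_[ℓ] {x}, aeval x p = (ℓ : ℤ_[ℓ]) • c := by
    intro p hp
    have hmon : (X ^ N - C (u : ℤ_[ℓ])).Monic := monic_X_pow_sub_C _ hN.ne'
    have hmap : (X ^ N - C (u : ℤ_[ℓ])).map PadicInt.toZMod = X ^ N - C (u : ZMod ℓ) := by simp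
    have h0 : (p %ₘ (X ^ N - C (u : ℤ_[ℓ]))).map PadicInt.toZMod = 0 := by
      rw [map_modByMonic _ hmon, hmap,
        modByMonic_eq_zero_iff_dvd (monic_X_pow_sub_C _ hN.ne')]
      exact hp
    obtain ⟨q, hq⟩ : C (ℓ : ℤ_[ℓ]) ∣ p %ₘ (X ^ N - C (u : ℤ_[ℓ])) := by
      rw [C_dvd_iff_dvd_coeff]
      intro s
      have := congrArg (fun f ↦ coeff f s) h0
      rw [coeff_map, coeff_zero] at this
      rwa [← RingHom.mem_ker, PadicInt.ker_toZMod, PadicInt.maximalIdeal_eq_span_p,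
        Ideal.mem_span_singleton] at this
    refine ⟨aeval x q, aeval_mem_adjoin_singleton _ _, ?_⟩
    have e := congrArg (aeval x) (modByMonic_add_div p (X ^ N - C (u : ℤ_[ℓ])))
    rw [← e, map_add, hq, map_mul, map_mul]
    simp [hxN, Algebra.smul_def]
  refine noZeroDivisors_of_basis (R := ℤ_[ℓ]) (Q := ℚ_[ℓ]) (Algebra.adjoin ℤ_[ℓ] {x}) _ hA₀ y N hN
    (ℓ : ℤ_[ℓ]) PadicInt.prime_p.ne_zero (eq_zero_of_forall_pow_dvd PadicInt.prime_p.not_isUnit)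
    ?_ hli hspan.symm ?_ ?_ ?_
  · rw [h.pow_right, map_natCast, map_natCast]
  · refine exists_mul_eq_mul_of_mem_adjoin _ _ ?_
    intro s hs
    rw [Set.mem_singleton_iff] at hs
    subst hs
    refine ⟨w' • s, Subalgebra.smul_mem _ (Algebra.self_mem_adjoin_singleton _ _) _, ?_⟩
    rw [← algebraMap_smul ℚ_[ℓ] w', hw', smul_mul_assoc]
    exact h.right_mul_left hω0
  · refine exists_mul_eq_mul_of_mem_adjoin' _ _ ?_
    intro s hs
    rw [Set.mem_singleton_iff] at hs
    subst hs
    refine ⟨w • s, Subalgebra.smul_mem _ (Algebra.self_mem_adjoin_singleton _ _) _, ?_⟩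
    rw [← algebraMap_smul ℚ_[ℓ] w, hw, mul_smul_comm]
    exact h.mul_eq
  · intro a ha b hb
    rw [Algebra.adjoin_singleton_eq_range_aeval] at ha hb
    obtain ⟨p, rfl⟩ := ha
    obtain ⟨q, rfl⟩ := hb
    rintro ⟨c, hc, e⟩
    rw [Algebra.adjoin_singleton_eq_range_aeval] at hc
    obtain ⟨r, rfl⟩ := hc
    have hdvd := aeval_eq_zero_imp_dvd hN hxN hlix (p * q - C (ℓ : ℤ_[ℓ]) * r) (by
      rw [map_sub, map_mul, map_mul, aeval_C, ← Algebra.smul_def]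
      exact sub_eq_zero.mpr e)
    have hdvd' := Polynomial.map_dvd PadicInt.toZMod hdvd
    have hz : (PadicInt.toZMod (ℓ : ℤ_[ℓ])) = 0 := by simp
    rw [Polynomial.map_sub, Polynomial.map_sub, Polynomial.map_mul, Polynomial.map_mul, map_C,
      map_C, hz, C_0, zero_mul, sub_zero, Polynomial.map_pow, map_X, map_natCast] at hdvd'
    exact (hu.prime.dvd_or_dvd hdvd').imp (hred p) (hred q)

/-! ### From a domain over `K` to the tensor product over `K(X)` -/

/-- A subalgebra generated by elements matching elements of a domain. -/
theorem mul_eq_zero_of_mem_adjoin {K D Δ κ : Type*} [Field K] [Ring D] [Ring Δ] [Algebra K D]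
    [Algebra K Δ] [NoZeroDivisors Δ] [Fintype κ] (T : Set (D × Δ)) (v : κ → D × Δ)
    (hv : Subalgebra.toSubmodule (Algebra.adjoin K T) = Submodule.span K (Set.range v))
    (h₁ : LinearIndependent K fun g ↦ (v g).1) (h₂ : LinearIndependent K fun g ↦ (v g).2) :
    ∀ x ∈ Algebra.adjoin K (Prod.fst '' T), ∀ y ∈ Algebra.adjoin K (Prod.fst '' T),
      x * y = 0 → x = 0 ∨ y = 0 := by
  have hmem : ∀ z ∈ Algebra.adjoin K T, ∃ c : κ → K, z = ∑ g, c g • v g := by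
    intro z hz
    rw [← Subalgebra.mem_toSubmodule, hv, Submodule.mem_span_range_iff_exists_fun] at hz
    exact hz.imp fun _ h ↦ h.symm
  -- Both projections are injective on the algebra generated in `D × Δ`, which is thus the graph of
  -- an isomorphism between its two images.
  have hfst : ∀ z ∈ Algebra.adjoin K T, z.1 = 0 → z = 0 := by
    intro z hz h0
    obtain ⟨c, rfl⟩ := hmem z hz
    rw [Prod.fst_sum] at h0
    exact Finset.sum_eq_zero fun g _ ↦ by
      rw [Fintype.linearIndependent_iff.mp h₁ c h0 g, zero_smul]
  have hsnd : ∀ z ∈ Algebra.adjoin K T, z.2 = 0 → z = 0 := by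
    intro z hz h0
    obtain ⟨c, rfl⟩ := hmem z hz
    rw [Prod.snd_sum] at h0
    exact Finset.sum_eq_zero fun g _ ↦ by
      rw [Fintype.linearIndependent_iff.mp h₂ c h0 g, zero_smul]
  have himage : Algebra.adjoin K (Prod.fst '' T) =
      (Algebra.adjoin K T).map (AlgHom.fst K D Δ) := (AlgHom.map_adjoin (AlgHom.fst K D Δ) T).symm
  rw [himage]
  rintro x' hx' y' hy' hxy
  obtain ⟨x, hx, rfl⟩ := Subalgebra.mem_map.mp hx'
  obtain ⟨y, hy, rfl⟩ := Subalgebra.mem_map.mp hy'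
  rw [AlgHom.fst_apply, AlgHom.fst_apply] at *
  have h0 : x * y = 0 := hfst _ (mul_mem hx hy) (by rw [Prod.fst_mul, hxy])
  have h0' : x.2 * y.2 = 0 := by rw [← Prod.snd_mul, h0, Prod.snd_zero]
  rcases mul_eq_zero.mp h0' with h | h
  · left; rw [hsnd x hx h, Prod.fst_zero]
  · right; rw [hsnd y hy h, Prod.fst_zero]

/-- A symbol pair over an extension with parameters from the base. -/
theorem IsSymbolPair.restrictScalars {K F A : Type*} [CommRing K] [CommRing F] [Algebra K F]
    [Ring A] [Algebra K A] [Algebra F A] [IsScalarTower K F A] {N : ℕ} {ω a b : K} {x y : A}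
    (h : IsSymbolPair N (algebraMap K F ω) (algebraMap K F a) (algebraMap K F b) x y) :
    IsSymbolPair N ω a b x y where
  pow_left := by rw [h.pow_left, ← IsScalarTower.algebraMap_apply]
  pow_right := by rw [h.pow_right, ← IsScalarTower.algebraMap_apply]
  mul_eq := by rw [h.mul_eq, algebraMap_smul]

open Polynomial in
/-- If `Δ` is a domain over `K` containing a symbol pair `(a, b)` and an `N₂`-th root of `c`
commuting with it, with independent monomials, then `(a, b) ⊗ (c, X)` has no zero divisors over the
fraction field of `K[X]`. -/
theorem noZeroDivisors_of_isSymbolPair {K F D Δ : Type*} [Field K] [Field F] [Algebra K[X] F]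
    [IsFractionRing K[X] F] [Algebra K F] [IsScalarTower K K[X] F] [Ring D] [Nontrivial D]
    [Algebra F D] [Ring Δ] [NoZeroDivisors Δ] [Algebra K Δ] {N₁ N₂ : ℕ} (hN₁ : 0 < N₁)
    (hN₂ : 0 < N₂) {ω₁ ω₂ a b c : K} (hω₁ : IsPrimitiveRoot ω₁ N₁) (hω₂ : IsPrimitiveRoot ω₂ N₂)
    (ha : a ≠ 0) (hb : b ≠ 0) (hc : c ≠ 0) {i j k m : D}
    (h₁ : IsSymbolPair N₁ (algebraMap K F ω₁) (algebraMap K F a) (algebraMap K F b) i j)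
    (h₂ : IsSymbolPair N₂ (algebraMap K F ω₂) (algebraMap K F c) (algebraMap K[X] F X) k m)
    (hki : Commute k i) (hkj : Commute k j) (hmi : Commute m i) (hmj : Commute m j)
    (htop : Algebra.adjoin F (insert m (insert k (insert j (insert i ∅)))) = ⊤)
    {i' j' k' : Δ} (h' : IsSymbolPair N₁ ω₁ a b i' j') (hk' : k' ^ N₂ = algebraMap K Δ c)
    (hki' : Commute k' i') (hkj' : Commute k' j')
    (hli' : LinearIndependent K fun p : ((Unit × Fin N₁) × Fin N₁) × Fin N₂ ↦
      1 * i' ^ (p.1.1.2 : ℕ) * j' ^ (p.1.2 : ℕ) * k' ^ (p.2 : ℕ)) :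
    NoZeroDivisors D := by
  let : Algebra K D := Algebra.compHom D (algebraMap K F)
  have : IsScalarTower K F D := IsScalarTower.of_algebraMap_eq fun _ ↦ rfl
  let : Algebra K[X] D := Algebra.compHom D (algebraMap K[X] F)
  have : IsScalarTower K[X] F D := IsScalarTower.of_algebraMap_eq fun _ ↦ rfl
  have : IsScalarTower K K[X] D := IsScalarTower.of_algebraMap_eq fun z ↦ by
    rw [IsScalarTower.algebraMap_apply K F D, IsScalarTower.algebraMap_apply K K[X] F]
    rfl
  have hXF : Function.Injective (algebraMap K[X] F) := IsFractionRing.injective _ _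
  have hω₁0 : ω₁ ≠ 0 := hω₁.ne_zero hN₁.ne'
  have hω₂0 : ω₂ ≠ 0 := hω₂.ne_zero hN₂.ne'
  have hKinj : Function.Injective (algebraMap K F) := (algebraMap K F).injective
  -- independence over `F`
  have hliF := h₁.linearIndependent hN₁ (hω₁.map_of_injective hKinj) (by simpa using ha)
    (by simpa using hb) (fun _ : Unit ↦ (1 : D)) (linearIndependent_one _ _)
    (fun _ ↦ Commute.one_right _) (fun _ ↦ Commute.one_right _)
  have hliF := h₂.linearIndependent hN₂ (hω₂.map_of_injective hKinj) (by simpa using hc)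
    (by rw [Ne, map_eq_zero_iff _ hXF]; exact X_ne_zero) _ hliF
    (fun g ↦ ((Commute.one_right k).mul_right (hki.pow_right _)).mul_right (hkj.pow_right _))
    (fun g ↦ ((Commute.one_right m).mul_right (hmi.pow_right _)).mul_right (hmj.pow_right _))
  have hspanF := h₁.toSubmodule_adjoin_eq_span hN₁ (IsUnit.mk0 _ (by simpa using hω₁0)) ∅ _
    (toSubmodule_adjoin_empty_eq_span _ _) (by simp) (by simp)
  have hspanF := h₂.toSubmodule_adjoin_eq_span hN₂ (IsUnit.mk0 _ (by simpa using hω₂0)) _ _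
    hspanF (by rintro s (rfl | rfl | h); exacts [hkj, hki, h.elim])
    (by rintro s (rfl | rfl | h); exacts [hmj, hmi, h.elim])
  rw [htop, Algebra.top_toSubmodule] at hspanF
  set b₀ : ((Unit × Fin N₁) × Fin N₁) × Fin N₂ → D := fun p ↦
    1 * i ^ (p.1.1.2 : ℕ) * j ^ (p.1.2 : ℕ) * k ^ (p.2 : ℕ) with hb₀
  have hlib : LinearIndependent F b₀ := by
    have := hliF.comp (fun p : ((Unit × Fin N₁) × Fin N₁) × Fin N₂ ↦ (p, (⟨0, hN₂⟩ : Fin N₂)))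
      (fun s t hst ↦ (Prod.ext_iff.mp hst).1)
    simpa only [Function.comp_def, pow_zero, mul_one] using this
  have hlibK : LinearIndependent K b₀ := hlib.restrict_scalars (fun x y hxy ↦ hKinj (by
    simpa [Algebra.smul_def] using hxy))
  have hlibX : LinearIndependent K[X] b₀ := hlib.restrict_scalars (fun x y hxy ↦ hXF (by
    simpa [Algebra.smul_def] using hxy))
  -- the subalgebras generated by `i`, `j`, `k` over `K` and `K[X]`
  have h₁K : IsSymbolPair N₁ ω₁ a b i j := h₁.restrictScalars
  have h₂k : k ^ N₂ = algebraMap K D c := by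
    rw [h₂.pow_left, ← IsScalarTower.algebraMap_apply]
  set T : Set D := insert k (insert j (insert i ∅)) with hT
  have hB := h₁K.toSubmodule_adjoin_eq_span hN₁ (IsUnit.mk0 _ hω₁0) ∅ _
    (toSubmodule_adjoin_empty_eq_span _ _) (by simp) (by simp)
  have hB := toSubmodule_adjoin_insert_eq_span _ _ hB k N₂ hN₂
    (by rw [h₂k]; exact algebraMap_mem _ _)
    (exists_mul_eq_mul_of_mem_adjoin _ _ (by
      rintro s (rfl | rfl | h)
      · exact ⟨s, Algebra.subset_adjoin (Set.mem_insert _ _), hkj⟩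
      · exact ⟨s, Algebra.subset_adjoin (Set.mem_insert_of_mem _ (Set.mem_insert _ _)), hki⟩
      · exact h.elim))
  have h₁X : IsSymbolPair N₁ (C ω₁) (C a) (C b) i j := by
    refine IsSymbolPair.restrictScalars (F := F) ?_
    simpa only [IsScalarTower.algebraMap_apply K K[X] F, Polynomial.algebraMap_eq] using h₁
  have hA₀ := h₁X.toSubmodule_adjoin_eq_span hN₁ ((IsUnit.mk0 _ hω₁0).map C) ∅ _
    (toSubmodule_adjoin_empty_eq_span _ _) (by simp) (by simp)
  have hA₀ := toSubmodule_adjoin_insert_eq_span _ _ hA₀ k N₂ hN₂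
    (by rw [h₂k, IsScalarTower.algebraMap_apply K K[X] D]; exact algebraMap_mem _ _)
    (exists_mul_eq_mul_of_mem_adjoin _ _ (by
      rintro s (rfl | rfl | h)
      · exact ⟨s, Algebra.subset_adjoin (Set.mem_insert _ _), hkj⟩
      · exact ⟨s, Algebra.subset_adjoin (Set.mem_insert_of_mem _ (Set.mem_insert _ _)), hki⟩
      · exact h.elim))
  -- The `K`-algebra `B` generated by `i, j, k` is a domain, by transport from `Δ` through the pairs
  -- `(i, i')`, `(j, j')`, `(k, k')`.
  have hBdom : ∀ x ∈ Algebra.adjoin K T, ∀ y ∈ Algebra.adjoin K T,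
      x * y = 0 → x = 0 ∨ y = 0 := by
    have hp : IsSymbolPair N₁ ω₁ a b ((i, i') : D × Δ) ((j, j') : D × Δ) :=
      ⟨Prod.ext h₁K.pow_left h'.pow_left, Prod.ext h₁K.pow_right h'.pow_right,
        Prod.ext h₁K.mul_eq h'.mul_eq⟩
    have hspan := hp.toSubmodule_adjoin_eq_span hN₁ (IsUnit.mk0 _ hω₁0) ∅ _
      (toSubmodule_adjoin_empty_eq_span _ _) (by simp) (by simp)
    have hspan := toSubmodule_adjoin_insert_eq_span _ _ hspan (k, k') N₂ hN₂
      (by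
        have : ((k, k') : D × Δ) ^ N₂ = algebraMap K (D × Δ) c := Prod.ext h₂k hk'
        rw [this]
        exact algebraMap_mem _ _)
      (exists_mul_eq_mul_of_mem_adjoin _ _ (by
        rintro s (rfl | rfl | h)
        · exact ⟨_, Algebra.subset_adjoin (Set.mem_insert _ _), Prod.ext hkj hkj'⟩
        · exact ⟨_, Algebra.subset_adjoin (Set.mem_insert_of_mem _ (Set.mem_insert _ _)),
            Prod.ext hki hki'⟩
        · exact h.elim))
    have := mul_eq_zero_of_mem_adjoin _ _ hspan
      (by simpa only [Prod.fst_mul, Prod.pow_fst, Prod.fst_one] using hlibK)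
      (by simpa only [Prod.snd_mul, Prod.pow_snd, Prod.snd_one] using hli')
    simpa only [Set.image_insert_eq, Set.image_empty] using this
  have hmem : ∀ x, x ∈ Algebra.adjoin K[X] T ↔ ∃ f : _ → K[X], ∑ g, f g • b₀ g = x := by
    intro x
    rw [← Subalgebra.mem_toSubmodule, hA₀, Submodule.mem_span_range_iff_exists_fun]
  have hmemK : ∀ x, x ∈ Algebra.adjoin K T ↔ ∃ f : _ → K, ∑ g, f g • b₀ g = x := by
    intro x
    rw [← Subalgebra.mem_toSubmodule, hB, Submodule.mem_span_range_iff_exists_fun]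
  have hsub : ∀ x ∈ Algebra.adjoin K T, x ∈ Algebra.adjoin K[X] T := by
    intro x hx
    obtain ⟨f, rfl⟩ := (hmemK x).mp hx
    exact (hmem _).mpr ⟨fun g ↦ C (f g), by
      simp only [← Polynomial.algebraMap_eq, algebraMap_smul]⟩
  -- Split off constant terms of the coordinates; with `hinter` this says that `A₀ / X` is `B`.
  have hdecomp : ∀ x ∈ Algebra.adjoin K[X] T, ∃ x₀ ∈ Algebra.adjoin K T,
      ∃ x₁ ∈ Algebra.adjoin K[X] T, x = x₀ + (X : K[X]) • x₁ := by
    intro x hx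
    obtain ⟨f, rfl⟩ := (hmem x).mp hx
    refine ⟨_, (hmemK _).mpr ⟨fun g ↦ (f g).coeff 0, rfl⟩, _, (hmem _).mpr
      ⟨fun g ↦ (f g).divX, rfl⟩, ?_⟩
    rw [Finset.smul_sum, ← Finset.sum_add_distrib]
    refine Finset.sum_congr rfl fun g _ ↦ ?_
    conv_lhs => rw [← divX_mul_X_add (f g), add_smul, mul_comm, mul_smul, add_comm,
      ← Polynomial.algebraMap_eq, algebraMap_smul]
  have hinter : ∀ x ∈ Algebra.adjoin K T, (∃ y ∈ Algebra.adjoin K[X] T, x = (X : K[X]) • y) →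
      x = 0 := by
    rintro x hx ⟨y, hy, e⟩
    obtain ⟨f, rfl⟩ := (hmemK x).mp hx
    obtain ⟨h, rfl⟩ := (hmem y).mp hy
    refine Finset.sum_eq_zero fun g _ ↦ ?_
    have := Fintype.linearIndependent_iff.mp hlibX (fun g ↦ C (f g) - X * h g) (by
      simp only [sub_smul, Finset.sum_sub_distrib, mul_smul, ← Finset.smul_sum, ← e]
      simp only [← Polynomial.algebraMap_eq, algebraMap_smul, sub_self]) g
    have := congrArg (fun p ↦ coeff p 0) this
    simp only [coeff_sub, coeff_C_zero, mul_coeff_zero, coeff_X_zero, zero_mul, sub_zero,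
      coeff_zero] at this
    rw [this, zero_smul]
  refine noZeroDivisors_of_basis (R := K[X]) (Q := F) (Algebra.adjoin K[X] T) b₀ hA₀ m N₂ hN₂ X
    X_ne_zero (eq_zero_of_forall_pow_dvd not_isUnit_X) ?_ hliF hspanF.symm ?_ ?_ ?_
  · rw [h₂.pow_right, ← IsScalarTower.algebraMap_apply]
  · refine exists_mul_eq_mul_of_mem_adjoin _ _ ?_
    rintro s (rfl | rfl | rfl | h)
    · refine ⟨C ω₂⁻¹ • s, Subalgebra.smul_mem _ (Algebra.subset_adjoin (Set.mem_insert _ _)) _, ?_⟩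
      rw [h₂.right_mul_left (by simpa using hω₂0), smul_mul_assoc, ← map_inv₀, algebraMap_smul,
        ← Polynomial.algebraMap_eq, algebraMap_smul]
    · exact ⟨s, Algebra.subset_adjoin (by simp [hT]), hmj⟩
    · exact ⟨s, Algebra.subset_adjoin (by simp [hT]), hmi⟩
    · exact h.elim
  · refine exists_mul_eq_mul_of_mem_adjoin' _ _ ?_
    rintro s (rfl | rfl | rfl | h)
    · refine ⟨C ω₂ • s, Subalgebra.smul_mem _ (Algebra.subset_adjoin (Set.mem_insert _ _)) _, ?_⟩
      rw [h₂.mul_eq, mul_smul_comm, algebraMap_smul, ← Polynomial.algebraMap_eq, algebraMap_smul]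
    · exact ⟨s, Algebra.subset_adjoin (by simp [hT]), hmj.symm⟩
    · exact ⟨s, Algebra.subset_adjoin (by simp [hT]), hmi.symm⟩
    · exact h.elim
  · rintro x hx y hy ⟨z, hz, e⟩
    obtain ⟨x₀, hx₀, x₁, hx₁, rfl⟩ := hdecomp x hx
    obtain ⟨y₀, hy₀, y₁, hy₁, rfl⟩ := hdecomp y hy
    have h0 : x₀ * y₀ = 0 := hinter _ (mul_mem hx₀ hy₀)
      ⟨z - x₀ * y₁ - x₁ * (y₀ + (X : K[X]) • y₁),
        sub_mem (sub_mem hz (mul_mem (hsub _ hx₀) hy₁)) (mul_mem hx₁ hy), by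
        rw [smul_sub, smul_sub, ← e]
        simp only [mul_add, add_mul, smul_add, smul_mul_assoc, mul_smul_comm]
        abel⟩
    refine (hBdom _ hx₀ _ hy₀ h0).imp (fun h ↦ ⟨x₁, hx₁, ?_⟩) (fun h ↦ ⟨y₁, hy₁, ?_⟩) <;>
    rw [h, zero_add]

/-! ### Roots of unity, radicals and embeddings in `p`-adic fields -/

open Polynomial in
/-- Hensel's lemma for `N`-th roots, `N` prime to the residue characteristic. -/
theorem PadicInt.exists_pow_eq_of_norm_sub_lt_one {ℓ : ℕ} [Fact ℓ.Prime] {N : ℕ}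
    (hN : N.Coprime ℓ) (c a : ℤ_[ℓ]) (ha : ‖a‖ = 1) (hac : ‖a ^ N - c‖ < 1) :
    ∃ z : ℤ_[ℓ], z ^ N = c ∧ ‖z - a‖ < 1 := by
  have hNn : ‖(N : ℤ_[ℓ])‖ = 1 := by
    rcases (PadicInt.norm_le_one (N : ℤ_[ℓ])).lt_or_eq with h | h
    · rw [PadicInt.norm_lt_one_iff_dvd] at h
      exfalso
      have h' : (ℓ : ℤ) ∣ (N : ℤ) := by
        rw [← PadicInt.norm_int_lt_one_iff_dvd (p := ℓ), PadicInt.norm_lt_one_iff_dvd]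
        exact_mod_cast h
      have := Nat.dvd_gcd (Int.natCast_dvd_natCast.mp h') dvd_rfl
      rw [hN] at this
      exact (Fact.out : ℓ.Prime).one_lt.ne' (Nat.dvd_one.mp this)
    · exact h
  -- The derivative `N a ^ (N - 1)` is a unit, so Hensel's bound reduces to `‖a ^ N - c‖ < 1`.
  have hder : ‖aeval a (derivative (X ^ N - C c : ℤ_[ℓ][X]))‖ = 1 := by
    simp [derivative_X_pow, norm_mul, norm_pow, ha, hNn]
  obtain ⟨z, hz, hza, -⟩ := hensels_lemma (F := (X ^ N - C c : ℤ_[ℓ][X])) (a := a) (by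
    rw [hder]
    simpa using hac)
  refine ⟨z, by simpa [sub_eq_zero] using hz, by rwa [hder] at hza⟩

theorem exists_isPrimitiveRoot_zmod {ℓ n : ℕ} [Fact ℓ.Prime] (hn : n ∣ ℓ - 1) :
    ∃ g : ZMod ℓ, IsPrimitiveRoot g n := by
  obtain ⟨m, hm⟩ := hn
  obtain ⟨g, hg⟩ := IsCyclic.exists_generator (α := (ZMod ℓ)ˣ)
  have hord : orderOf g = ℓ - 1 := by
    rw [orderOf_eq_card_of_forall_mem_zpowers hg, Nat.card_eq_fintype_card, ZMod.card_units]
  have hprim : IsPrimitiveRoot g (ℓ - 1) := hord ▸ IsPrimitiveRoot.orderOf g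
  have hpos : 0 < ℓ - 1 := Nat.sub_pos_of_lt (Fact.out : ℓ.Prime).one_lt
  exact ⟨_, IsPrimitiveRoot.coe_units_iff.mpr (hprim.pow hpos (hm.trans (mul_comm _ _)))⟩

/-- Hensel lifts a primitive root of unity from `𝔽_ℓ`; the lift stays primitive because any relation
`z ^ k = 1` can be reduced modulo `ℓ`. -/
theorem PadicInt.exists_isPrimitiveRoot {ℓ n : ℕ} [Fact ℓ.Prime] (hn0 : 0 < n) (hn : n ∣ ℓ - 1) :
    ∃ z : ℤ_[ℓ], IsPrimitiveRoot z n := by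
  obtain ⟨g, hg⟩ := exists_isPrimitiveRoot_zmod hn
  obtain ⟨a, rfl⟩ := ZMod.ringHom_surjective (PadicInt.toZMod (p := ℓ)) g
  have hlt : ∀ x : ℤ_[ℓ], ‖x‖ < 1 ↔ PadicInt.toZMod x = 0 := fun x ↦ by
    rw [← RingHom.mem_ker, PadicInt.ker_toZMod, IsLocalRing.mem_maximalIdeal,
      PadicInt.mem_nonunits]
  have hpos : 0 < ℓ - 1 := Nat.sub_pos_of_lt (Fact.out : ℓ.Prime).one_lt
  have hcop : n.Coprime ℓ := by
    refine Nat.Coprime.symm ((Nat.Prime.coprime_iff_not_dvd Fact.out).mpr fun h ↦ ?_)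
    have := Nat.le_of_dvd hpos (h.trans hn)
    omega
  have ha : ‖a‖ = 1 := by
    refine (PadicInt.norm_le_one a).lt_or_eq.resolve_left fun h ↦ ?_
    exact hg.ne_zero hn0.ne' ((hlt a).mp h)
  obtain ⟨z, hz, hza⟩ := PadicInt.exists_pow_eq_of_norm_sub_lt_one hcop 1 a ha (by
    rw [hlt]; simp [hg.pow_eq_one])
  refine ⟨z, hz, fun k hk ↦ hg.dvd_of_pow_eq_one k ?_⟩
  rw [hlt, map_sub, sub_eq_zero] at hza
  rw [← hza, ← map_pow, hk, map_one]

-- A generator `g` of the cyclic group `𝔽_ℓˣ` works: `(g ^ e) ^ N = g ^ d` forces `e * N ≡ d` modulo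
-- `ℓ - 1`, a multiple of `N`, hence `N ∣ d`.
open Polynomial in
theorem exists_irreducible_X_pow_sub_C_zmod {ℓ N : ℕ} [Fact ℓ.Prime] (hN0 : 0 < N)
    (hN : N ∣ ℓ - 1) : ∃ u : ℕ, u ≠ 0 ∧ Irreducible (X ^ N - C (u : ZMod ℓ)) := by
  obtain ⟨g, hg⟩ := IsCyclic.exists_generator (α := (ZMod ℓ)ˣ)
  have hord : orderOf g = ℓ - 1 := by
    rw [orderOf_eq_card_of_forall_mem_zpowers hg, Nat.card_eq_fintype_card, ZMod.card_units]
  have hcast : (((g : ZMod ℓ).val : ℕ) : ZMod ℓ) = g := ZMod.natCast_zmod_val _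
  refine ⟨(g : ZMod ℓ).val, fun h ↦ g.ne_zero ((ZMod.val_eq_zero _).mp h), ?_⟩
  rw [hcast]
  refine irreducible_X_pow_sub_C_of_forall_pow_eq hN0 _ fun b d hbd ↦ ?_
  have hb : IsUnit b := by
    rw [← isUnit_pow_iff hN0.ne', hbd]
    exact g.isUnit.pow d
  obtain ⟨b, rfl⟩ := hb
  have hbd' : b ^ N = g ^ d := Units.ext (by simpa using hbd)
  obtain ⟨e, rfl⟩ := (mem_powers_iff_mem_zpowers (x := g)).mpr (hg b)
  simp only at hbd'
  rw [← pow_mul, pow_eq_pow_iff_modEq, hord] at hbd'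
  exact (Nat.ModEq.dvd_iff (hbd'.of_dvd hN) dvd_rfl).mp (dvd_mul_left _ _)

-- Eisenstein at `r` over `ℤ_[r]`, then Gauss's lemma for `ℚ_[r]`; irreducibility descends along
-- `ψ`.
open Polynomial in
theorem irreducible_X_pow_sub_C_of_padic {K : Type*} [Field K] {r N : ℕ} [Fact r.Prime]
    (ψ : K →+* ℚ_[r]) (hN : 0 < N) : Irreducible (X ^ N - C (r : K)) := by
  have hmon : ∀ {R : Type} [CommRing R] (c : R), (X ^ N - C c : R[X]).Monic :=
    fun c ↦ monic_X_pow_sub_C c hN.ne'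
  have h₁ : Irreducible (X ^ N - C (r : ℤ_[r])) := by
    have hdeg : (X ^ N - C (r : ℤ_[r])).degree = (N : WithBot ℕ) := degree_X_pow_sub_C hN _
    refine irreducible_of_eisenstein_criterion (P := IsLocalRing.maximalIdeal ℤ_[r])
      inferInstance ?_ ?_ ?_ ?_ (hmon _).isPrimitive
    · rw [(hmon _).leadingCoeff]
      exact fun h ↦ (Ideal.ne_top_iff_one _).mp (IsLocalRing.maximalIdeal.isMaximal _).ne_top h
    · intro s hs
      rw [hdeg] at hs
      have hs' : s < N := by exact_mod_cast hs
      rw [PadicInt.maximalIdeal_eq_span_p, Ideal.mem_span_singleton, coeff_sub, coeff_X_pow,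
        if_neg hs'.ne, coeff_C]
      split_ifs <;> simp
    · rw [hdeg]
      exact_mod_cast hN
    · rw [PadicInt.maximalIdeal_eq_span_p, Ideal.span_singleton_pow, Ideal.mem_span_singleton]
      simp only [coeff_sub, coeff_X_pow, if_neg hN.ne, coeff_C_zero, zero_sub, dvd_neg]
      rintro ⟨q, hq⟩
      refine PadicInt.prime_p.not_isUnit (IsUnit.of_mul_eq_one q (mul_left_cancel₀
        (PadicInt.prime_p (p := r)).ne_zero ?_))
      rw [mul_one, ← mul_assoc, ← sq, ← hq]
  have h₂ : Irreducible (X ^ N - C (r : ℚ_[r])) := by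
    have := ((hmon (r : ℤ_[r])).irreducible_iff_irreducible_map_fraction_map
      (K := ℚ_[r])).mp h₁
    simpa using this
  refine (monic_X_pow_sub_C (r : K) hN.ne').irreducible_of_irreducible_map ψ _ ?_
  simpa using h₂

theorem linearIndependent_pow_of_irreducible {K A : Type*} [Field K] [Field A] [Algebra K A]
    {N : ℕ} {c : K} {s : A} (hirr : Irreducible (Polynomial.X ^ N - Polynomial.C c))
    (hN : 0 < N) (hs : s ^ N = algebraMap K A c) :
    LinearIndependent K fun e : Fin N ↦ s ^ (e : ℕ) := by
  have hmin : minpoly K s = Polynomial.X ^ N - Polynomial.C c :=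
    (minpoly.eq_of_irreducible_of_monic hirr (by simp [hs])
      (Polynomial.monic_X_pow_sub_C c hN.ne')).symm
  have hdeg : (minpoly K s).natDegree = N := by rw [hmin, Polynomial.natDegree_X_pow_sub_C]
  have := linearIndependent_pow (K := K) s
  rwa [hdeg] at this

/-- A number field `ℚ(ζ)`, `ζ` a primitive `n`-th root of unity, embeds into `ℚ_[ℓ]` if `ℓ` is
`1` modulo `n`. -/
theorem nonempty_ringHom_padic {E : Type*} [Field E] [CharZero E] {n : ℕ} (hn0 : 0 < n) {ζ : E}
    (hζ : IsPrimitiveRoot ζ n) {ℓ : ℕ} [Fact ℓ.Prime] (hn : n ∣ ℓ - 1) :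
    Nonempty (ℚ⟮ζ⟯ →+* ℚ_[ℓ]) := by
  obtain ⟨z, hz⟩ := PadicInt.exists_isPrimitiveRoot hn0 hn
  have hz' : IsPrimitiveRoot (z : ℚ_[ℓ]) n :=
    hz.map_of_injective (f := algebraMap ℤ_[ℓ] ℚ_[ℓ]) (IsFractionRing.injective _ _)
  have hint : IsIntegral ℚ ζ := (hζ.isIntegral hn0).tower_top
  refine ⟨((IntermediateField.adjoin.powerBasis hint).lift (z : ℚ_[ℓ]) ?_).toRingHom⟩
  -- The minimal polynomial of `ζ` is cyclotomic, so any primitive `n`-th root in `ℚ_[ℓ]` is a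
  -- legitimate image of `ζ`.
  rw [IntermediateField.adjoin.powerBasis_gen, IntermediateField.minpoly_gen,
    ← Polynomial.cyclotomic_eq_minpoly_rat hζ hn0, Polynomial.aeval_def,
    Polynomial.eval₂_eq_eval_map, Polynomial.map_cyclotomic]
  exact hz'.isRoot_cyclotomic hn0

/-! ### Construction of the division algebra -/

theorem exists_isSymbolPair_adjoin_eq_top {F : Type u} [Field F] {N : ℕ} (hN : 0 < N) {ω : F}
    (hω : IsPrimitiveRoot ω N) (a b : F) :
    ∃ (A : Type u) (_ : Ring A) (_ : Algebra F A) (_ : Nontrivial A) (x y : A),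
      IsSymbolPair N ω a b x y ∧ Algebra.adjoin F {y, x} = ⊤ := by
  obtain ⟨A, _, _, _, x, y, h⟩ := exists_isSymbolPair hN hω a b
  let S := Algebra.adjoin F ({y, x} : Set A)
  let x' : S := ⟨x, Algebra.subset_adjoin (by simp)⟩
  let y' : S := ⟨y, Algebra.subset_adjoin (by simp)⟩
  refine ⟨S, inferInstance, inferInstance, inferInstance, x', y',
    h.of_map S.val Subtype.val_injective, ?_⟩
  have hset : (((↑) : S → A) ⁻¹' {y, x}) = {y', x'} := by
    ext s
    simp [x', y', Subtype.ext_iff]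
  rw [← hset]
  exact Algebra.adjoin_adjoin_coe_preimage

/-- A tensor product of two symbol algebras. -/
theorem exists_isSymbolPair_tensor {F : Type u} [Field F] {N₁ N₂ : ℕ} (hN₁ : 0 < N₁)
    (hN₂ : 0 < N₂) {ω₁ ω₂ : F} (hω₁ : IsPrimitiveRoot ω₁ N₁) (hω₂ : IsPrimitiveRoot ω₂ N₂)
    (a b c d : F) :
    ∃ (A : Type u) (_ : Ring A) (_ : Algebra F A) (_ : Nontrivial A) (i j k m : A),
      IsSymbolPair N₁ ω₁ a b i j ∧ IsSymbolPair N₂ ω₂ c d k m ∧ Commute k i ∧ Commute k j ∧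
        Commute m i ∧ Commute m j ∧
        Algebra.adjoin F (insert m (insert k (insert j (insert i ∅)))) = ⊤ := by
  obtain ⟨A, _, _, _, i, j, h⟩ := exists_isSymbolPair hN₁ hω₁ a b
  obtain ⟨B, _, _, _, k, m, h'⟩ := exists_isSymbolPair hN₂ hω₂ c d
  have hA := h.map (Algebra.TensorProduct.includeLeft : A →ₐ[F] A ⊗[F] B)
  have hB := h'.map (Algebra.TensorProduct.includeRight : B →ₐ[F] A ⊗[F] B)
  have hcomm : ∀ (x : A) (y : B), Commute (Algebra.TensorProduct.includeRight y : A ⊗[F] B)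
      ((Algebra.TensorProduct.includeLeft : A →ₐ[F] A ⊗[F] B) x) := fun x y ↦ by
    simp [Commute, SemiconjBy]
  generalize (Algebra.TensorProduct.includeLeft : A →ₐ[F] A ⊗[F] B) = f at *
  generalize (Algebra.TensorProduct.includeRight : B →ₐ[F] A ⊗[F] B) = g at *
  let T : Set (A ⊗[F] B) := insert (g m) (insert (g k) (insert (f j) (insert (f i) ∅)))
  let S := Algebra.adjoin F T
  let i' : S := ⟨f i, Algebra.subset_adjoin (by simp [T])⟩
  let j' : S := ⟨f j, Algebra.subset_adjoin (by simp [T])⟩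
  let k' : S := ⟨g k, Algebra.subset_adjoin (by simp [T])⟩
  let m' : S := ⟨g m, Algebra.subset_adjoin (by simp [T])⟩
  refine ⟨S, inferInstance, inferInstance, inferInstance, i', j', k', m',
    hA.of_map S.val Subtype.val_injective, hB.of_map S.val Subtype.val_injective,
    Subtype.ext (hcomm i k), Subtype.ext (hcomm j k), Subtype.ext (hcomm i m),
    Subtype.ext (hcomm j m), ?_⟩
  have hset : (((↑) : S → A ⊗[F] B) ⁻¹' T) = insert m' (insert k' (insert j' (insert i' ∅))) := by
    ext s
    simp [T, i', j', k', m', Subtype.ext_iff]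
  rw [← hset]
  exact Algebra.adjoin_adjoin_coe_preimage

/-- Over a field `K` embedding into suitable `p`-adic fields there are parameters `a`, `b`, `c` such
that `(a, b) ⊗ K(c ^ (1 / N₂))` embeds into a `p`-adic division algebra. -/
theorem exists_padic_domain {E : Type u} [Field E] [CharZero E] {N₁ N₂ : ℕ} (hN₁ : 0 < N₁)
    (hN₂ : 0 < N₂) {ζ : E} (hζ : IsPrimitiveRoot ζ (N₁ * N₂)) {ω₁ : ℚ⟮ζ⟯}
    (hω₁ : IsPrimitiveRoot ω₁ N₁) :
    ∃ a b c : ℚ⟮ζ⟯, a ≠ 0 ∧ b ≠ 0 ∧ c ≠ 0 ∧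
    ∃ (Δ : Type) (_ : Ring Δ) (_ : NoZeroDivisors Δ) (_ : Algebra ℚ⟮ζ⟯ Δ) (i j k : Δ),
      IsSymbolPair N₁ ω₁ a b i j ∧ k ^ N₂ = algebraMap ℚ⟮ζ⟯ Δ c ∧ Commute k i ∧ Commute k j ∧
      LinearIndependent ℚ⟮ζ⟯ fun p : ((Unit × Fin N₁) × Fin N₁) × Fin N₂ ↦
        1 * i ^ (p.1.1.2 : ℕ) * j ^ (p.1.2 : ℕ) * k ^ (p.2 : ℕ) := by
  have hn : 0 < N₁ * N₂ := Nat.mul_pos hN₁ hN₂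
  obtain ⟨ℓ, hℓ, -, hℓn⟩ := Nat.exists_prime_gt_modEq_one (k := N₁ * N₂) 1 hn.ne'
  have hℓ' := Fact.mk hℓ
  -- The factor `N₁ * N₂` lets `ℚ(ζ)` embed into `ℚ_[r]`; the factor `ℓ` makes `r` an `N₂`-th power
  -- in `ℤ_[ℓ]`, by Hensel starting from `1`.
  obtain ⟨r, hr, -, hrn⟩ := Nat.exists_prime_gt_modEq_one (k := N₁ * N₂ * ℓ) 1
    (Nat.mul_pos hn hℓ.pos).ne'
  have hr' := Fact.mk hr
  have hℓd : N₁ * N₂ ∣ ℓ - 1 := (Nat.modEq_iff_dvd' hℓ.one_lt.le).mp hℓn.symm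
  have hrd : N₁ * N₂ * ℓ ∣ r - 1 := (Nat.modEq_iff_dvd' hr.one_lt.le).mp hrn.symm
  obtain ⟨φ⟩ := nonempty_ringHom_padic hn hζ hℓd
  obtain ⟨ψ⟩ := nonempty_ringHom_padic hn hζ ((dvd_mul_right _ _).trans hrd)
  obtain ⟨u, hu0, hu⟩ := exists_irreducible_X_pow_sub_C_zmod hN₁ ((dvd_mul_right _ _).trans hℓd)
  have hcop : N₂.Coprime ℓ := by
    refine Nat.Coprime.symm ((Nat.Prime.coprime_iff_not_dvd hℓ).mpr fun h ↦ ?_)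
    have := Nat.le_of_dvd (Nat.sub_pos_of_lt hℓ.one_lt)
      ((h.trans (dvd_mul_left _ _)).trans hℓd)
    have := hℓ.one_lt
    omega
  obtain ⟨s, hs, -⟩ := PadicInt.exists_pow_eq_of_norm_sub_lt_one hcop (r : ℤ_[ℓ]) 1 norm_one (by
    rw [one_pow, norm_sub_rev, PadicInt.norm_lt_one_iff_dvd]
    have h : ℓ ∣ r - 1 := (dvd_mul_left _ _).trans hrd
    have := Nat.cast_dvd_cast (α := ℤ_[ℓ]) h
    rwa [Nat.cast_sub hr.one_lt.le, Nat.cast_one] at this)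
  have hs' : (s : ℚ_[ℓ]) ^ N₂ = r := by
    rw [← PadicInt.coe_pow, hs]
    simp
  obtain ⟨A, _, _, _, x, y, h, htop⟩ := exists_isSymbolPair_adjoin_eq_top hN₁
    (hω₁.map_of_injective φ.injective) (u : ℚ_[ℓ]) (ℓ : ℚ_[ℓ])
  have hdom := h.noZeroDivisors_padic hN₁ (hω₁.map_of_injective φ.injective) hu hu0 htop
  refine ⟨u, ℓ, r, by exact_mod_cast hu0, by exact_mod_cast hℓ.ne_zero,
    by exact_mod_cast hr.ne_zero, ?_⟩
  let : Algebra ℚ⟮ζ⟯ ℚ_[ℓ] := φ.toAlgebra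
  let : Algebra ℚ⟮ζ⟯ A := Algebra.compHom A φ
  have : IsScalarTower ℚ⟮ζ⟯ ℚ_[ℓ] A := IsScalarTower.of_algebraMap_eq fun _ ↦ rfl
  have hφ : algebraMap ℚ⟮ζ⟯ ℚ_[ℓ] = φ := rfl
  refine ⟨A, inferInstance, hdom, inferInstance, x, y, algebraMap ℚ_[ℓ] A s, ?_, ?_,
    Algebra.commutes _ _, Algebra.commutes _ _, ?_⟩
  · refine IsSymbolPair.restrictScalars (F := ℚ_[ℓ]) ?_
    rw [hφ, map_natCast, map_natCast]
    exact h
  · rw [← map_pow, hs', map_natCast, map_natCast]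
  · have h₁ := h.linearIndependent hN₁ (hω₁.map_of_injective φ.injective)
      (by exact_mod_cast hu0) (by exact_mod_cast hℓ.ne_zero) (fun _ : Unit ↦ (1 : A))
      (linearIndependent_one _ _) (fun _ ↦ Commute.one_right _) (fun _ ↦ Commute.one_right _)
    have h₂ := linearIndependent_pow_of_irreducible (A := ℚ_[ℓ])
      (irreducible_X_pow_sub_C_of_padic ψ hN₂) hN₂ (hs'.trans (map_natCast _ r).symm)
    -- Tower argument: the powers of `s` are independent over `ℚ(ζ)` inside `ℚ_[ℓ]`, and the
    -- monomials in `x, y` are independent over `ℚ_[ℓ]`.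
    have h₃ := (linearIndependent_smul h₂ h₁).comp Prod.swap Prod.swap_injective
    convert h₃ using 2 with p
    simp only [Function.comp_apply, Prod.fst_swap, Prod.snd_swap]
    rw [← map_pow, ← Algebra.commutes, ← Algebra.smul_def]

open Polynomial in
/-- A tensor product of two symbol algebras over `ℚ(ζ)(t)` that is a division algebra. -/
theorem exists_divisionRing {E : Type u} [Field E] [CharZero E] {N₁ N₂ : ℕ} (hN₁ : 0 < N₁)
    (hN₂ : 0 < N₂) {ζ : E} (hζ : IsPrimitiveRoot ζ (N₁ * N₂)) :
    ∃ (ω₁ ω₂ a b c d : RatFunc ℚ⟮ζ⟯), IsPrimitiveRoot ω₁ N₁ ∧ IsPrimitiveRoot ω₂ N₂ ∧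
      a ≠ 0 ∧ b ≠ 0 ∧ c ≠ 0 ∧ d ≠ 0 ∧
    ∃ (D : Type u) (_ : DivisionRing D) (_ : Algebra (RatFunc ℚ⟮ζ⟯) D) (i j k m : D),
      IsSymbolPair N₁ ω₁ a b i j ∧ IsSymbolPair N₂ ω₂ c d k m ∧ Commute k i ∧ Commute k j ∧
        Commute m i ∧ Commute m j ∧
        Algebra.adjoin (RatFunc ℚ⟮ζ⟯) (insert m (insert k (insert j (insert i ∅)))) = ⊤ ∧
        FiniteDimensional (RatFunc ℚ⟮ζ⟯) D := by
  have hn : 0 < N₁ * N₂ := Nat.mul_pos hN₁ hN₂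
  have hgen : IsPrimitiveRoot (IntermediateField.AdjoinSimple.gen ℚ ζ) (N₁ * N₂) := by
    refine IsPrimitiveRoot.of_map_of_injective (f := algebraMap ℚ⟮ζ⟯ E) ?_
      (algebraMap ℚ⟮ζ⟯ E).injective
    rwa [IntermediateField.AdjoinSimple.algebraMap_gen]
  have hω₁ := hgen.pow hn (mul_comm N₁ N₂)
  have hω₂ := hgen.pow hn rfl
  obtain ⟨a, b, c, ha, hb, hc, Δ, _, _, _, i', j', k', h', hk', hki', hkj', hli'⟩ :=
    exists_padic_domain hN₁ hN₂ hζ hω₁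
  have hinj : Function.Injective (algebraMap ℚ⟮ζ⟯ (RatFunc ℚ⟮ζ⟯)) := RingHom.injective _
  have hω₁F := hω₁.map_of_injective hinj
  have hω₂F := hω₂.map_of_injective hinj
  have hXF : algebraMap ℚ⟮ζ⟯[X] (RatFunc ℚ⟮ζ⟯) X ≠ 0 := by
    rw [Ne, map_eq_zero_iff _ (IsFractionRing.injective _ _)]
    exact X_ne_zero
  obtain ⟨D, _, _, _, i, j, k, m, h₁, h₂, hki, hkj, hmi, hmj, htop⟩ :=
    exists_isSymbolPair_tensor hN₁ hN₂ hω₁F hω₂F (algebraMap ℚ⟮ζ⟯ (RatFunc ℚ⟮ζ⟯) a)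
      (algebraMap ℚ⟮ζ⟯ _ b) (algebraMap ℚ⟮ζ⟯ _ c) (algebraMap ℚ⟮ζ⟯[X] _ X)
  have hdom : NoZeroDivisors D := noZeroDivisors_of_isSymbolPair hN₁ hN₂ hω₁ hω₂ ha hb hc h₁ h₂
    hki hkj hmi hmj htop h' hk' hki' hkj' hli'
  have hfin : FiniteDimensional (RatFunc ℚ⟮ζ⟯) D := by
    have hspanF := h₁.toSubmodule_adjoin_eq_span hN₁ (IsUnit.mk0 _ (hω₁F.ne_zero hN₁.ne')) ∅ _
      (toSubmodule_adjoin_empty_eq_span _ _) (by simp) (by simp)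
    have hspanF := h₂.toSubmodule_adjoin_eq_span hN₂ (IsUnit.mk0 _ (hω₂F.ne_zero hN₂.ne')) _ _
      hspanF (by rintro s (rfl | rfl | h); exacts [hkj, hki, h.elim])
      (by rintro s (rfl | rfl | h); exacts [hmj, hmi, h.elim])
    rw [htop, Algebra.top_toSubmodule] at hspanF
    exact ⟨hspanF ▸ Submodule.fg_span (Set.finite_range _)⟩
  -- A finite-dimensional algebra without zero divisors is a division ring.
  have hD : IsDomain D := NoZeroDivisors.to_isDomain D
  exact ⟨_, _, _, _, _, _, hω₁F, hω₂F, by simpa using ha, by simpa using hb, by simpa using hc,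
    hXF, D, divisionRingOfFiniteDimensional (RatFunc ℚ⟮ζ⟯) D, inferInstance, i, j, k, m, h₁, h₂,
    hki, hkj, hmi, hmj, htop, hfin⟩

/-! ### Centralizers, Kummer theory and the maximal subfield -/

theorem mul_eq_smul_mul {R A : Type*} [CommRing R] [Ring A] [Algebra R A] {p q : R} {x y z : A}
    (hy : x * y = p • (y * x)) (hz : x * z = q • (z * x)) :
    x * (y * z) = (p * q) • (y * z * x) := by
  rw [← mul_assoc, hy, smul_mul_assoc, mul_assoc, hz, mul_smul_comm, smul_smul, mul_assoc]

/-- An element commuting with a unit `x` is a combination of those basis elements that commute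
with `x`, if conjugation by `x` is diagonal. -/
theorem eq_one_of_commute_of_coeff_ne_zero {F A κ : Type*} [Field F] [Ring A] [Algebra F A]
    [Fintype κ] {v : κ → A} (hv : LinearIndependent F v) {x : A} (hx : IsUnit x) {χ : κ → F}
    (hχ : ∀ g, x * v g = χ g • (v g * x)) {c : κ → F}
    (hc : Commute x (∑ g, c g • v g)) {g : κ} (hg : c g ≠ 0) : χ g = 1 := by
  -- The left side is the commutator of `x` with the given combination.
  have h : (∑ g, (c g * (χ g - 1)) • v g) * x = 0 * x := by
    have := hc.eq
    rw [Finset.mul_sum, Finset.sum_mul, ← sub_eq_zero, ← Finset.sum_sub_distrib] at this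
    rw [zero_mul, ← this, Finset.sum_mul]
    refine Finset.sum_congr rfl fun g _ ↦ ?_
    rw [mul_smul_comm, hχ, smul_mul_assoc, smul_mul_assoc, mul_sub, sub_smul, mul_one, mul_smul]
  have := Fintype.linearIndependent_iff.mp hv _ (hx.mul_right_cancel h) g
  exact sub_eq_zero.mp ((mul_eq_zero.mp this).resolve_left hg)

/-- A commutative subalgebra of a finite-dimensional division algebra is a field. -/
theorem exists_field_range_eq {F D : Type u} [Field F] [DivisionRing D] [Algebra F D]
    [FiniteDimensional F D] (S : Subalgebra F D) (hS : ∀ x ∈ S, ∀ y ∈ S, x * y = y * x) :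
    ∃ (L : Type u) (_ : Field L) (_ : Algebra F L) (f : L →ₐ[F] D), f.range = S := by
  let : CommRing S := { (inferInstance : Ring S) with
    mul_comm := fun x y ↦ Subtype.ext (hS _ x.2 _ y.2) }
  have : IsDomain S := NoZeroDivisors.to_isDomain S
  exact ⟨S, fieldOfFiniteDimensional F S, inferInstance, S.val, S.range_val⟩

/-- The Kummer character of a radical. -/
theorem exists_kummer_character {F L : Type*} [Field F] [Field L] [Algebra F L] {l : ℕ}
    [NeZero l] {ω : F} (hω : IsPrimitiveRoot ω l) {x : L} (hx0 : x ≠ 0) {a : F}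
    (hx : x ^ l = algebraMap F L a) :
    ∃ θ : Gal(L/F) →* rootsOfUnity l L, ∀ σ, σ x = ((θ σ : Lˣ) : L) * x := by
  -- All `l`-th roots of unity lie in `F`; this makes `σ ↦ σ x / x` multiplicative.
  have hfix : ∀ (σ : Gal(L/F)) (η : L), η ^ l = 1 → σ η = η := by
    intro σ η hη
    obtain ⟨i, -, rfl⟩ := (hω.map_of_injective (algebraMap F L).injective).eq_pow_of_pow_eq_one hη
    rw [← map_pow, σ.commutes]
  have hroot : ∀ σ : Gal(L/F), (σ x / x) ^ l = 1 := by
    intro σ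
    rw [div_pow, ← map_pow, hx, σ.commutes, ← hx, div_self (pow_ne_zero _ hx0)]
  refine ⟨MonoidHom.mk' (fun σ ↦ rootsOfUnity.mkOfPowEq (σ x / x) (hroot σ))
    fun σ τ ↦ ?_, fun σ ↦ ?_⟩
  · refine Subtype.ext (Units.ext ?_)
    simp only [rootsOfUnity.coe_mkOfPowEq, Subgroup.coe_mul, Units.val_mul]
    have := hfix σ _ (hroot τ)
    rw [map_div₀] at this
    rw [AlgEquiv.mul_apply, ← this]
    have hσ : σ x ≠ 0 := by simpa using hx0
    field_simp
  · simp [div_mul_cancel₀ _ hx0]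

theorem nonempty_rootsOfUnity_mulEquiv {L : Type*} [Field L] {l : ℕ} [NeZero l] {ω : L}
    (hω : IsPrimitiveRoot ω l) : Nonempty (rootsOfUnity l L ≃* Multiplicative (ZMod l)) := by
  refine ⟨mulEquivOfCyclicCardEq ?_⟩
  rw [show Nat.card (Multiplicative (ZMod l)) = l from Nat.card_zmod l]
  exact hω.card_rootsOfUnity

/-- A Kummer extension generated by four radicals, of the largest possible degree. -/
theorem isGalois_of_four_radicals {F L : Type*} [Field F] [CharZero F] [Field L] [Algebra F L]
    [FiniteDimensional F L] {l₁ l₂ l₃ l₄ : ℕ} [NeZero l₁] [NeZero l₂] [NeZero l₃] [NeZero l₄]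
    {ω₁ ω₂ ω₃ ω₄ a₁ a₂ a₃ a₄ : F} (hω₁ : IsPrimitiveRoot ω₁ l₁) (hω₂ : IsPrimitiveRoot ω₂ l₂)
    (hω₃ : IsPrimitiveRoot ω₃ l₃) (hω₄ : IsPrimitiveRoot ω₄ l₄) {x₁ x₂ x₃ x₄ : L}
    (hx₁ : x₁ ^ l₁ = algebraMap F L a₁) (hx₂ : x₂ ^ l₂ = algebraMap F L a₂)
    (hx₃ : x₃ ^ l₃ = algebraMap F L a₃) (hx₄ : x₄ ^ l₄ = algebraMap F L a₄)
    (h₁ : x₁ ≠ 0) (h₂ : x₂ ≠ 0) (h₃ : x₃ ≠ 0) (h₄ : x₄ ≠ 0)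
    (htop : Algebra.adjoin F {x₁, x₂, x₃, x₄} = ⊤)
    (hrank : Module.finrank F L = l₁ * l₂ * l₃ * l₄) :
    IsGalois F L ∧
      Nonempty (Gal(L/F) ≃* Multiplicative (ZMod l₁ × ZMod l₂ × ZMod l₃ × ZMod l₄)) := by
  have hsplit : ∀ {l : ℕ} [NeZero l] {ω a : F} {x : L}, IsPrimitiveRoot ω l →
      x ^ l = algebraMap F L a →
      ((Polynomial.X ^ l - Polynomial.C a : Polynomial F).map (algebraMap F L)).Splits := by
    intro l _ ω a x hω hx
    rw [Polynomial.map_sub, Polynomial.map_pow, Polynomial.map_X, Polynomial.map_C]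
    exact X_pow_sub_C_splits_of_isPrimitiveRoot
      (hω.map_of_injective (algebraMap F L).injective) hx
  have hne : ∀ (l : ℕ) [NeZero l] (a : F), (Polynomial.X ^ l - Polynomial.C a : Polynomial F) ≠ 0 :=
    fun l _ a ↦ (Polynomial.monic_X_pow_sub_C a (NeZero.ne l)).ne_zero
  let P : Polynomial F := (Polynomial.X ^ l₁ - Polynomial.C a₁) *
    ((Polynomial.X ^ l₂ - Polynomial.C a₂) * ((Polynomial.X ^ l₃ - Polynomial.C a₃) *
      (Polynomial.X ^ l₄ - Polynomial.C a₄)))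
  have hP0 : P ≠ 0 := mul_ne_zero (hne _ _)
    (mul_ne_zero (hne _ _) (mul_ne_zero (hne _ _) (hne _ _)))
  have hPsplit : P.IsSplittingField F L := by
    refine ⟨?_, ?_⟩
    · simp only [P, Polynomial.map_mul]
      exact (hsplit hω₁ hx₁).mul ((hsplit hω₂ hx₂).mul ((hsplit hω₃ hx₃).mul (hsplit hω₄ hx₄)))
    · rw [eq_top_iff, ← htop]
      refine Algebra.adjoin_mono ?_
      rintro x hx
      rw [Polynomial.mem_rootSet]
      refine ⟨hP0, ?_⟩
      rcases hx with rfl | rfl | rfl | rfl <;> simp [P, *]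
  have hnormal : Normal F L := Normal.of_isSplittingField P
  have hgal : IsGalois F L := ⟨⟩
  refine ⟨hgal, ?_⟩
  obtain ⟨θ₁, hθ₁⟩ := exists_kummer_character hω₁ h₁ hx₁
  obtain ⟨θ₂, hθ₂⟩ := exists_kummer_character hω₂ h₂ hx₂
  obtain ⟨θ₃, hθ₃⟩ := exists_kummer_character hω₃ h₃ hx₃
  obtain ⟨θ₄, hθ₄⟩ := exists_kummer_character hω₄ h₄ hx₄
  have hinj := (algebraMap F L).injective
  obtain ⟨e₁⟩ := nonempty_rootsOfUnity_mulEquiv (hω₁.map_of_injective hinj)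
  obtain ⟨e₂⟩ := nonempty_rootsOfUnity_mulEquiv (hω₂.map_of_injective hinj)
  obtain ⟨e₃⟩ := nonempty_rootsOfUnity_mulEquiv (hω₃.map_of_injective hinj)
  obtain ⟨e₄⟩ := nonempty_rootsOfUnity_mulEquiv (hω₄.map_of_injective hinj)
  let e : rootsOfUnity l₁ L × rootsOfUnity l₂ L × rootsOfUnity l₃ L × rootsOfUnity l₄ L ≃*
      Multiplicative (ZMod l₁ × ZMod l₂ × ZMod l₃ × ZMod l₄) :=
    (e₁.prodCongr ((e₂.prodCongr ((e₃.prodCongr e₄).trans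
      (MulEquiv.prodMultiplicative _ _).symm)).trans (MulEquiv.prodMultiplicative _ _).symm)).trans
      (MulEquiv.prodMultiplicative _ _).symm
  let Θ := θ₁.prod (θ₂.prod (θ₃.prod θ₄))
  have hΘ : Function.Injective Θ := by
    rw [injective_iff_map_eq_one]
    intro σ hσ
    simp only [Θ, MonoidHom.prod_apply, Prod.mk_eq_one] at hσ
    obtain ⟨hσ₁, hσ₂, hσ₃, hσ₄⟩ := hσ
    have : (σ : L →ₐ[F] L) = AlgHom.id F L := by
      refine AlgHom.ext_of_adjoin_eq_top htop ?_
      rintro x (rfl | rfl | rfl | rfl)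
      · simpa [hσ₁] using hθ₁ σ
      · simpa [hσ₂] using hθ₂ σ
      · simpa [hσ₃] using hθ₃ σ
      · simpa [hσ₄] using hθ₄ σ
    exact AlgEquiv.ext fun x ↦ DFunLike.congr_fun this x
  have hcard : Nat.card Gal(L/F) =
      Nat.card (rootsOfUnity l₁ L × rootsOfUnity l₂ L × rootsOfUnity l₃ L × rootsOfUnity l₄ L) := by
    rw [IsGalois.card_aut_eq_finrank, hrank, Nat.card_congr e.toEquiv]
    change _ = Nat.card (ZMod l₁ × ZMod l₂ × ZMod l₃ × ZMod l₄)
    simp [mul_assoc]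
  -- The four characters determine an automorphism on the generators, and the degree hypothesis
  -- makes the cardinalities agree.
  have hbij : Function.Bijective Θ := (Nat.bijective_iff_injective_and_card Θ).mpr ⟨hΘ, hcard⟩
  exact ⟨(MulEquiv.ofBijective Θ hbij).trans e⟩

section

variable {F D : Type*} [Field F] [Ring D] [Algebra F D] {N₁ N₂ : ℕ}
  {ω₁ ω₂ a b c d : F} {i j k m : D}

/-- The monomials in two commuting symbol pairs. -/
def symbolMonomial (N₁ N₂ : ℕ) (i j k m : D)
    (p : (((Unit × Fin N₁) × Fin N₁) × Fin N₂) × Fin N₂) : D :=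
  1 * i ^ (p.1.1.1.2 : ℕ) * j ^ (p.1.1.2 : ℕ) * k ^ (p.1.2 : ℕ) * m ^ (p.2 : ℕ)

theorem linearIndependent_symbolMonomial [Nontrivial D] (hN₁ : 0 < N₁) (hN₂ : 0 < N₂)
    (hω₁ : IsPrimitiveRoot ω₁ N₁) (hω₂ : IsPrimitiveRoot ω₂ N₂)
    (ha : a ≠ 0) (hb : b ≠ 0) (hc : c ≠ 0) (hd : d ≠ 0)
    (h₁ : IsSymbolPair N₁ ω₁ a b i j) (h₂ : IsSymbolPair N₂ ω₂ c d k m)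
    (hki : Commute k i) (hkj : Commute k j) (hmi : Commute m i) (hmj : Commute m j) :
    LinearIndependent F (symbolMonomial N₁ N₂ i j k m) := by
  have hli := h₁.linearIndependent hN₁ hω₁ ha hb (fun _ : Unit ↦ (1 : D))
    (linearIndependent_one _ _) (fun _ ↦ Commute.one_right _) (fun _ ↦ Commute.one_right _)
  have := h₂.linearIndependent hN₂ hω₂ hc hd _ hli
    (fun g ↦ ((Commute.one_right k).mul_right (hki.pow_right _)).mul_right (hkj.pow_right _))
    (fun g ↦ ((Commute.one_right m).mul_right (hmi.pow_right _)).mul_right (hmj.pow_right _))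
  exact this

theorem span_symbolMonomial (hN₁ : 0 < N₁) (hN₂ : 0 < N₂)
    (hω₁ : IsPrimitiveRoot ω₁ N₁) (hω₂ : IsPrimitiveRoot ω₂ N₂)
    (h₁ : IsSymbolPair N₁ ω₁ a b i j) (h₂ : IsSymbolPair N₂ ω₂ c d k m)
    (hki : Commute k i) (hkj : Commute k j) (hmi : Commute m i) (hmj : Commute m j)
    (htop : Algebra.adjoin F (insert m (insert k (insert j (insert i ∅)))) = ⊤) :
    Submodule.span F (Set.range (symbolMonomial N₁ N₂ i j k m)) = ⊤ := by
  have hspan := h₁.toSubmodule_adjoin_eq_span hN₁ (IsUnit.mk0 _ (hω₁.ne_zero hN₁.ne')) ∅ _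
    (toSubmodule_adjoin_empty_eq_span _ _) (by simp) (by simp)
  have hspan := h₂.toSubmodule_adjoin_eq_span hN₂ (IsUnit.mk0 _ (hω₂.ne_zero hN₂.ne')) _ _
    hspan (by rintro s (rfl | rfl | h); exacts [hkj, hki, h.elim])
    (by rintro s (rfl | rfl | h); exacts [hmj, hmi, h.elim])
  rw [htop, Algebra.top_toSubmodule] at hspan
  exact hspan.symm

/-- The monomials occurring in an element commuting with powers of the generators. -/
theorem dvd_of_commute_pow [Nontrivial D] (hN₁ : 0 < N₁) (hN₂ : 0 < N₂)
    (hω₁ : IsPrimitiveRoot ω₁ N₁) (hω₂ : IsPrimitiveRoot ω₂ N₂)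
    (ha : a ≠ 0) (hb : b ≠ 0) (hc : c ≠ 0) (hd : d ≠ 0)
    (h₁ : IsSymbolPair N₁ ω₁ a b i j) (h₂ : IsSymbolPair N₂ ω₂ c d k m)
    (hki : Commute k i) (hkj : Commute k j) (hmi : Commute m i) (hmj : Commute m j)
    (f : (((Unit × Fin N₁) × Fin N₁) × Fin N₂) × Fin N₂ → F) {e₁ e₂ e₃ e₄ : ℕ}
    (hi : Commute (i ^ e₁) (∑ p, f p • symbolMonomial N₁ N₂ i j k m p))
    (hj : Commute (j ^ e₂) (∑ p, f p • symbolMonomial N₁ N₂ i j k m p))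
    (hk : Commute (k ^ e₃) (∑ p, f p • symbolMonomial N₁ N₂ i j k m p))
    (hm : Commute (m ^ e₄) (∑ p, f p • symbolMonomial N₁ N₂ i j k m p))
    {p : (((Unit × Fin N₁) × Fin N₁) × Fin N₂) × Fin N₂} (hp : f p ≠ 0) :
    N₁ ∣ e₁ * p.1.1.2 ∧ N₁ ∣ e₂ * p.1.1.1.2 ∧ N₂ ∣ e₃ * p.2 ∧ N₂ ∣ e₄ * p.1.2 := by
  have hli := linearIndependent_symbolMonomial hN₁ hN₂ hω₁ hω₂ ha hb hc hd h₁ h₂ hki hkj hmi hmj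
  have comm : ∀ {x y : D}, Commute x y → ∀ s t : ℕ, x ^ s * y ^ t = (1 : F) • (y ^ t * x ^ s) :=
    fun h s t ↦ by rw [one_smul]; exact h.pow_pow s t
  have one : ∀ x : D, x * 1 = (1 : F) • (1 * x) := by simp
  have quad : ∀ {x : D} {q₁ q₂ q₃ q₄ : F} {y₁ y₂ y₃ y₄ : D}, x * y₁ = q₁ • (y₁ * x) →
      x * y₂ = q₂ • (y₂ * x) → x * y₃ = q₃ • (y₃ * x) → x * y₄ = q₄ • (y₄ * x) →
      x * (1 * y₁ * y₂ * y₃ * y₄) = (1 * q₁ * q₂ * q₃ * q₄) • (1 * y₁ * y₂ * y₃ * y₄ * x) :=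
    fun h₁ h₂ h₃ h₄ ↦ mul_eq_smul_mul (mul_eq_smul_mul (mul_eq_smul_mul (mul_eq_smul_mul
      (one _) h₁) h₂) h₃) h₄
  refine ⟨?_, ?_, ?_, ?_⟩
  · have := eq_one_of_commute_of_coeff_ne_zero hli ((h₁.isUnit_left hN₁ ha).pow e₁)
      (fun p ↦ quad (comm (Commute.refl i) _ _) (pow_mul_pow_eq_smul h₁.mul_eq _ _)
        (comm hki.symm _ _) (comm hmi.symm _ _)) hi hp
    simp only [one_mul, mul_one] at this
    exact hω₁.dvd_of_pow_eq_one _ this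
  · have := eq_one_of_commute_of_coeff_ne_zero hli ((h₁.isUnit_right hN₁ hb).pow e₂)
      (fun p ↦ quad (pow_mul_pow_eq_smul (h₁.right_mul_left (hω₁.ne_zero hN₁.ne')) _ _)
        (comm (Commute.refl j) _ _) (comm hkj.symm _ _) (comm hmj.symm _ _)) hj hp
    simp only [one_mul, mul_one] at this
    exact hω₁.inv.dvd_of_pow_eq_one _ this
  · have := eq_one_of_commute_of_coeff_ne_zero hli ((h₂.isUnit_left hN₂ hc).pow e₃)
      (fun p ↦ quad (comm hki _ _) (comm hkj _ _) (comm (Commute.refl k) _ _)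
        (pow_mul_pow_eq_smul h₂.mul_eq _ _)) hk hp
    simp only [one_mul] at this
    exact hω₂.dvd_of_pow_eq_one _ this
  · have := eq_one_of_commute_of_coeff_ne_zero hli ((h₂.isUnit_right hN₂ hd).pow e₄)
      (fun p ↦ quad (comm hmi _ _) (comm hmj _ _)
        (pow_mul_pow_eq_smul (h₂.right_mul_left (hω₂.ne_zero hN₂.ne')) _ _)
        (comm (Commute.refl m) _ _)) hm hp
    simp only [one_mul, mul_one] at this
    exact hω₂.inv.dvd_of_pow_eq_one _ this

end

/-- The degree of an algebra generated by four radicals with independent monomials. -/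
theorem finrank_eq_of_four_radicals {F A : Type*} [Field F] [CommRing A]
    [Algebra F A] {l₁ l₂ l₃ l₄ : ℕ} (hl₁ : 0 < l₁) (hl₂ : 0 < l₂) (hl₃ : 0 < l₃) (hl₄ : 0 < l₄)
    {a₁ a₂ a₃ a₄ : F} {x₁ x₂ x₃ x₄ : A}
    (hx₁ : x₁ ^ l₁ = algebraMap F A a₁) (hx₂ : x₂ ^ l₂ = algebraMap F A a₂)
    (hx₃ : x₃ ^ l₃ = algebraMap F A a₃) (hx₄ : x₄ ^ l₄ = algebraMap F A a₄)
    (htop : Algebra.adjoin F {x₁, x₂, x₃, x₄} = ⊤)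
    (hli : LinearIndependent F fun p : (((Unit × Fin l₁) × Fin l₂) × Fin l₃) × Fin l₄ ↦
      1 * x₁ ^ (p.1.1.1.2 : ℕ) * x₂ ^ (p.1.1.2 : ℕ) * x₃ ^ (p.1.2 : ℕ) * x₄ ^ (p.2 : ℕ)) :
    Module.finrank F A = l₁ * l₂ * l₃ * l₄ := by
  have hcomm : ∀ (T : Set A) (x : A), ∀ s ∈ Algebra.adjoin F T,
      ∃ s' ∈ Algebra.adjoin F T, x * s = s' * x := fun T x s hs ↦ ⟨s, hs, mul_comm x s⟩
  have h₁ := toSubmodule_adjoin_insert_eq_span _ _ (toSubmodule_adjoin_empty_eq_span F A) x₁ l₁ hl₁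
    (by rw [hx₁]; exact algebraMap_mem _ _) (hcomm _ _)
  have h₂ := toSubmodule_adjoin_insert_eq_span _ _ h₁ x₂ l₂ hl₂
    (by rw [hx₂]; exact algebraMap_mem _ _) (hcomm _ _)
  have h₃ := toSubmodule_adjoin_insert_eq_span _ _ h₂ x₃ l₃ hl₃
    (by rw [hx₃]; exact algebraMap_mem _ _) (hcomm _ _)
  have h₄ := toSubmodule_adjoin_insert_eq_span _ _ h₃ x₄ l₄ hl₄
    (by rw [hx₄]; exact algebraMap_mem _ _) (hcomm _ _)
  have hset : insert x₄ (insert x₃ (insert x₂ (insert x₁ ∅))) = ({x₁, x₂, x₃, x₄} : Set A) := by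
    ext s
    simp only [Set.mem_insert_iff, Set.mem_singleton_iff, Set.mem_empty_iff_false]
    tauto
  rw [hset, htop, Algebra.top_toSubmodule] at h₄
  have := finrank_span_eq_card hli
  rw [← h₄, finrank_top] at this
  rw [this]
  simp [mul_assoc]

/-- The field generated by suitable powers of the generators of a tensor product of two symbol
algebras is a maximal subfield. -/
theorem isAdmissible_of_isSymbolPair {F D : Type u} [Field F] [CharZero F] [DivisionRing D]
    [Algebra F D] [FiniteDimensional F D] {l₁ l₂ l₃ l₄ : ℕ} (hl₁ : 0 < l₁) (hl₂ : 0 < l₂)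
    (hl₃ : 0 < l₃) (hl₄ : 0 < l₄) {ω₁ ω₂ a b c d : F} (hω₁ : IsPrimitiveRoot ω₁ (l₁ * l₂))
    (hω₂ : IsPrimitiveRoot ω₂ (l₃ * l₄)) (ha : a ≠ 0) (hb : b ≠ 0) (hc : c ≠ 0) (hd : d ≠ 0)
    {i j k m : D} (h₁ : IsSymbolPair (l₁ * l₂) ω₁ a b i j)
    (h₂ : IsSymbolPair (l₃ * l₄) ω₂ c d k m)
    (hki : Commute k i) (hkj : Commute k j) (hmi : Commute m i) (hmj : Commute m j)
    (htop : Algebra.adjoin F (insert m (insert k (insert j (insert i ∅)))) = ⊤) :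
    IsAdmissible F (Multiplicative (ZMod l₁ × ZMod l₂ × ZMod l₃ × ZMod l₄)) := by
  have hN₁ : 0 < l₁ * l₂ := Nat.mul_pos hl₁ hl₂
  have hN₂ : 0 < l₃ * l₄ := Nat.mul_pos hl₃ hl₄
  have hli := linearIndependent_symbolMonomial hN₁ hN₂ hω₁ hω₂ ha hb hc hd h₁ h₂ hki hkj hmi hmj
  have hspan := span_symbolMonomial hN₁ hN₂ hω₁ hω₂ h₁ h₂ hki hkj hmi hmj htop
  have hcoord : ∀ z : D, ∃ f : _ → F, ∑ p, f p • symbolMonomial (l₁ * l₂) (l₃ * l₄) i j k m p = z :=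
    fun z ↦ (Submodule.mem_span_range_iff_exists_fun F).mp (hspan ▸ Submodule.mem_top)
  set S := Algebra.adjoin F {i ^ l₂, j ^ l₁, k ^ l₄, m ^ l₃} with hS
  -- commutativity of `S`
  have hij : Commute (i ^ l₂) (j ^ l₁) := by
    rw [Commute, SemiconjBy, pow_mul_pow_eq_smul h₁.mul_eq, mul_comm l₂, hω₁.pow_eq_one, one_smul]
  have hkm : Commute (k ^ l₄) (m ^ l₃) := by
    rw [Commute, SemiconjBy, pow_mul_pow_eq_smul h₂.mul_eq, mul_comm l₄, hω₂.pow_eq_one, one_smul]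
  have hSgen : ∀ x ∈ ({i ^ l₂, j ^ l₁, k ^ l₄, m ^ l₃} : Set D),
      ∀ y ∈ ({i ^ l₂, j ^ l₁, k ^ l₄, m ^ l₃} : Set D), x * y = y * x := by
    have e₁ := hki.pow_pow l₄ l₂
    have e₂ := hkj.pow_pow l₄ l₁
    have e₃ := hmi.pow_pow l₃ l₂
    have e₄ := hmj.pow_pow l₃ l₁
    rintro x (rfl | rfl | rfl | rfl) y (rfl | rfl | rfl | rfl)
    exacts [rfl, hij, e₁.symm, e₃.symm, hij.symm, rfl, e₂.symm, e₄.symm, e₁, e₂, rfl, hkm,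
      e₃, e₄, hkm.symm, rfl]
  have hScomm : ∀ x ∈ S, ∀ y ∈ S, x * y = y * x := fun x hx y hy ↦
    congrArg Subtype.val ((Algebra.isMulCommutative_adjoin F hSgen).is_comm.comm ⟨x, hx⟩ ⟨y, hy⟩)
  -- elements commuting with `S` are in `S`
  have hSmax : ∀ z, Commute (i ^ l₂) z → Commute (j ^ l₁) z → Commute (k ^ l₄) z →
      Commute (m ^ l₃) z → z ∈ S := by
    intro z hi hj hk hm
    obtain ⟨f, rfl⟩ := hcoord z
    refine sum_mem fun p _ ↦ ?_
    by_cases hp : f p = 0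
    · rw [hp, zero_smul]
      exact zero_mem S
    -- The roles cross: commuting with `i ^ l₂` gives `l₁ * l₂ ∣ l₂ * s` for the exponent `s` of
    -- `j`, so `l₁ ∣ s` and `j ^ s` is a power of `j ^ l₁`; likewise for the others.
    obtain ⟨h₁', h₂', h₃', h₄'⟩ := dvd_of_commute_pow hN₁ hN₂ hω₁ hω₂ ha hb hc hd h₁ h₂ hki hkj
      hmi hmj f hi hj hk hm hp
    replace h₁' := (dvd_of_eq (mul_comm l₂ l₁)).trans h₁'
    replace h₃' := (dvd_of_eq (mul_comm l₄ l₃)).trans h₃'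
    have hpow : ∀ {x : D} {l s : ℕ}, x ^ l ∈ S → l ∣ s → x ^ s ∈ S := by
      rintro x l _ hx ⟨s, rfl⟩
      rw [pow_mul]
      exact pow_mem hx s
    have hgen : ∀ x ∈ ({i ^ l₂, j ^ l₁, k ^ l₄, m ^ l₃} : Set D), x ∈ S :=
      fun x hx ↦ Algebra.subset_adjoin hx
    exact S.smul_mem (mul_mem (mul_mem (mul_mem (mul_mem (one_mem S)
      (hpow (hgen _ (by simp)) (Nat.dvd_of_mul_dvd_mul_left hl₁ h₂')))
      (hpow (hgen _ (by simp)) (Nat.dvd_of_mul_dvd_mul_left hl₂ h₁')))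
      (hpow (hgen _ (by simp)) (Nat.dvd_of_mul_dvd_mul_left hl₃ h₄')))
      (hpow (hgen _ (by simp)) (Nat.dvd_of_mul_dvd_mul_left hl₄ h₃'))) _
  have hcentral : Algebra.IsCentral F D := by
    -- Commuting with the generators themselves makes each exponent a multiple of `N₁` or `N₂` and
    -- below it, hence `0`.
    refine ⟨fun z hz ↦ ?_⟩
    obtain ⟨f, rfl⟩ := hcoord z
    have hz' : ∀ x, Commute x _ := fun x ↦ (Subalgebra.mem_center_iff.mp hz x)
    refine sum_mem fun p _ ↦ ?_
    by_cases hp : f p = 0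
    · rw [hp, zero_smul]
      exact zero_mem _
    obtain ⟨h₁', h₂', h₃', h₄'⟩ := dvd_of_commute_pow hN₁ hN₂ hω₁ hω₂ ha hb hc hd h₁ h₂ hki hkj
      hmi hmj f (e₁ := 1) (e₂ := 1) (e₃ := 1) (e₄ := 1) (hz' _) (hz' _) (hz' _) (hz' _) hp
    rw [one_mul] at h₁' h₂' h₃' h₄'
    refine Subalgebra.smul_mem _ ?_ _
    rw [symbolMonomial, Nat.eq_zero_of_dvd_of_lt h₁' p.1.1.2.2,
      Nat.eq_zero_of_dvd_of_lt h₂' p.1.1.1.2.2, Nat.eq_zero_of_dvd_of_lt h₃' p.2.2,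
      Nat.eq_zero_of_dvd_of_lt h₄' p.1.2.2]
    simp
  obtain ⟨L, _, _, φ, hφ⟩ := exists_field_range_eq S hScomm
  have hφinj : Function.Injective φ := φ.toRingHom.injective
  have : FiniteDimensional F L := FiniteDimensional.of_injective φ.toLinearMap hφinj
  have hmem : ∀ x ∈ ({i ^ l₂, j ^ l₁, k ^ l₄, m ^ l₃} : Set D), ∃ y, φ y = x := fun x hx ↦ by
    rw [← AlgHom.mem_range, hφ]
    exact Algebra.subset_adjoin hx
  obtain ⟨x₁, hx₁⟩ := hmem (i ^ l₂) (by simp)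
  obtain ⟨x₂, hx₂⟩ := hmem (j ^ l₁) (by simp)
  obtain ⟨x₃, hx₃⟩ := hmem (k ^ l₄) (by simp)
  obtain ⟨x₄, hx₄⟩ := hmem (m ^ l₃) (by simp)
  have hr₁ : x₁ ^ l₁ = algebraMap F L a := hφinj (by
    rw [map_pow, hx₁, ← pow_mul, mul_comm, h₁.pow_left, φ.commutes])
  have hr₂ : x₂ ^ l₂ = algebraMap F L b := hφinj (by
    rw [map_pow, hx₂, ← pow_mul, h₁.pow_right, φ.commutes])
  have hr₃ : x₃ ^ l₃ = algebraMap F L c := hφinj (by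
    rw [map_pow, hx₃, ← pow_mul, mul_comm, h₂.pow_left, φ.commutes])
  have hr₄ : x₄ ^ l₄ = algebraMap F L d := hφinj (by
    rw [map_pow, hx₄, ← pow_mul, h₂.pow_right, φ.commutes])
  have hne : ∀ {x : L} {l : ℕ} {e : F}, 0 < l → e ≠ 0 → x ^ l = algebraMap F L e → x ≠ 0 := by
    rintro _ l e hl he h rfl
    rw [zero_pow hl.ne', eq_comm, map_eq_zero] at h
    exact he h
  have htopL : Algebra.adjoin F {x₁, x₂, x₃, x₄} = ⊤ := by
    refine Subalgebra.map_injective (f := φ) hφinj ?_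
    rw [AlgHom.map_adjoin, Algebra.map_top, hφ, hS]
    simp only [Set.image_insert_eq, Set.image_singleton, hx₁, hx₂, hx₃, hx₄]
  have hrank := finrank_eq_of_four_radicals hl₁ hl₂ hl₃ hl₄ hr₁ hr₂ hr₃ hr₄ htopL (by
    refine LinearIndependent.of_comp φ.toLinearMap ?_
    have hlt : ∀ {s t : ℕ} (x : Fin s), 0 < t → t * x < t * s := fun x ht ↦
      Nat.mul_lt_mul_of_pos_left x.2 ht
    -- Monomials in the four radicals are distinct basis monomials of `D`, with exponents scaled by
    -- `l₂, l₁, l₄, l₃`.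
    have := hli.comp (fun p : (((Unit × Fin l₁) × Fin l₂) × Fin l₃) × Fin l₄ ↦
      (((((), (⟨l₂ * p.1.1.1.2, by rw [mul_comm l₁]; exact hlt _ hl₂⟩ : Fin (l₁ * l₂))),
        (⟨l₁ * p.1.1.2, hlt _ hl₁⟩ : Fin (l₁ * l₂))),
        (⟨l₄ * p.1.2, by rw [mul_comm l₃]; exact hlt _ hl₄⟩ : Fin (l₃ * l₄))),
        (⟨l₃ * p.2, hlt _ hl₃⟩ : Fin (l₃ * l₄)))) (by
      rintro ⟨⟨⟨⟨⟨⟩, p₁⟩, p₂⟩, p₃⟩, p₄⟩ ⟨⟨⟨⟨⟨⟩, q₁⟩, q₂⟩, q₃⟩, q₄⟩ h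
      simp only [Prod.mk.injEq, Fin.mk.injEq, true_and, Nat.mul_right_inj hl₁.ne',
        Nat.mul_right_inj hl₂.ne', Nat.mul_right_inj hl₃.ne', Nat.mul_right_inj hl₄.ne',
        Fin.val_inj] at h
      obtain ⟨⟨⟨rfl, rfl⟩, rfl⟩, rfl⟩ := h
      rfl)
    convert this using 1
    funext p
    simp only [Function.comp_apply, AlgHom.toLinearMap_apply, map_mul, map_pow, map_one, hx₁, hx₂,
      hx₃, hx₄, symbolMonomial, pow_mul])
  have := NeZero.of_pos hl₁
  have := NeZero.of_pos hl₂
  have := NeZero.of_pos hl₃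
  have := NeZero.of_pos hl₄
  obtain ⟨hgal, hiso⟩ := isGalois_of_four_radicals (hω₁.pow hN₁ (mul_comm l₁ l₂)) (hω₁.pow hN₁ rfl)
    (hω₂.pow hN₂ (mul_comm l₃ l₄)) (hω₂.pow hN₂ rfl) hr₁ hr₂ hr₃ hr₄ (hne hl₁ ha hr₁)
    (hne hl₂ hb hr₂) (hne hl₃ hc hr₃) (hne hl₄ hd hr₄) htopL hrank
  refine ⟨L, inferInstance, inferInstance, inferInstance, hgal, hiso, D, inferInstance,
    inferInstance, φ, hcentral, inferInstance, ?_, ?_⟩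
  · rintro _ ⟨x, rfl⟩ _ ⟨y, rfl⟩
    rw [← map_mul, ← map_mul, mul_comm]
  -- A commutative `T` above the image of `L` centralizes the generators of `S`, so it lies in `S`.
  · intro T hT hle z hz
    have hzx : ∀ x : L, Commute (φ x) z := fun x ↦ hT _ (hle ⟨x, rfl⟩) _ hz
    have hzS : z ∈ φ.range := by
      rw [hφ]
      exact hSmax z (hx₁ ▸ hzx x₁) (hx₂ ▸ hzx x₂) (hx₃ ▸ hzx x₃) (hx₄ ▸ hzx x₄)
    obtain ⟨x, rfl⟩ := hzS
    exact ⟨x, rfl⟩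

theorem corollary4p6 {E : Type*} [Field E] [CharZero E] (p : ℕ) (hp : p.Prime)
    (l₁ l₂ l₃ l₄ : ℕ) (h₁ : l₁.Coprime p) (h₂ : l₂.Coprime p) (h₃ : l₃.Coprime p)
    (h₄ : l₄.Coprime p) (ζ : E) (hζ : IsPrimitiveRoot ζ (l₁ * l₂ * l₃ * l₄)) :
    IsAdmissible (RatFunc ℚ⟮ζ⟯)
      (Multiplicative (ZMod l₁ × ZMod l₂ × ZMod l₃ × ZMod l₄)) := by
  -- `Nat.Coprime 0 p` would mean `p = 1`.
  have hpos : ∀ {l : ℕ}, l.Coprime p → 0 < l := by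
    intro l hl
    refine Nat.pos_of_ne_zero ?_
    rintro rfl
    exact hp.one_lt.ne' (by simpa using hl)
  rw [mul_assoc (l₁ * l₂)] at hζ
  obtain ⟨ω₁, ω₂, a, b, c, d, hω₁, hω₂, ha, hb, hc, hd, D, _, _, i, j, k, m, hij, hkm, hki, hkj,
    hmi, hmj, htop, _⟩ := exists_divisionRing (Nat.mul_pos (hpos h₁) (hpos h₂))
      (Nat.mul_pos (hpos h₃) (hpos h₄)) hζ
  have : CharZero (RatFunc ℚ⟮ζ⟯) :=
    charZero_of_injective_algebraMap (algebraMap ℚ⟮ζ⟯ (RatFunc ℚ⟮ζ⟯)).injective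
  exact isAdmissible_of_isSymbolPair (hpos h₁) (hpos h₂) (hpos h₃) (hpos h₄) hω₁ hω₂ ha hb hc hd
    hij hkm hki hkj hmi hmj htop
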